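/- Let $n\ge 2$, $1<p<\infty$, $0<\alpha\le 1$, and let $\beta\in\mathbb{R}$ satisfy $\beta p>-\alpha$. Let $\Omega\subset\mathbb{R}^n$ be a bounded Hölder-$\alpha$ domain, that is, a nonempty bounded connected open set such that every point of $\partial\Omega$ is the origin of a Cartesian coordinate system $(x',x_n)\in\mathbb{R}^{n-1}\times\mathbb{R}$ for which there are $r,h>0$ and a function $\varphi:\{|x'|<r\}\to\mathbb{R}$ with $|\varphi(x')-\varphi(y')|\le K_\varphi|x'-y'|^\alpha$ for all $x',y'$ and some constant $K_\varphi$, such that a point with $|x'|<r$, $|x_n|<h$ belongs to $\Omega$ if and only if $x_n<\varphi(x')$. Let $d(x)$ denote the distance from $x$ to $\partial\Omega$, and for $\gamma\in\mathbb{R}$ and a measurable (scalar or vector valued) function $g$ on $\Omega$ put $$\|g\|_{L^p(\Omega,d^{\gamma})}=\Big(\int_\Omega |g(x)|^p\,d(x)^{\gamma}\,dx\Big)^{1/p}\in[0,\infty].$$ Then there is a constant $C<\infty$, depending only on $n,p,\alpha,\beta$ and $\Omega$, such that every $f\in L^p(\Omega,d^{\beta p})$ which has a locally integrable weak gradient $\nabla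 f$ on $\Omega$ and satisfies $\int_\Omega f\,d^{\beta p}\,dx=0$ fulfils $$\|f\|_{L^p(\Omega,d^{\beta p})}\le C\,\|\nabla f\|_{L^p(\Omega,d^{(\beta+\alpha)p})}.$$ -/

import Mathlib

open MeasureTheory Set
open scoped NNReal ENNReal ContDiff

/-- A bounded Hölder-`α` domain of `ℝⁿ`: a nonempty connected bounded open set which, near each of
its boundary points `z`, is the set of points lying strictly below the graph of a Hölder-`α`
function. Here `T` is a Cartesian coordinate system `x ↦ (x', xₙ)` with origin `z`, and the
description is valid on the cylinder `|x'| < r`, `|xₙ| < h`. -/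
def IsHolderDomain {n : ℕ} (α : ℝ≥0) (Ω : Set (EuclideanSpace ℝ (Fin n))) : Prop :=
  IsOpen Ω ∧ IsConnected Ω ∧ Bornology.IsBounded Ω ∧
    ∀ z ∈ frontier Ω,
      ∃ (T : EuclideanSpace ℝ (Fin n) ≃ᵃⁱ[ℝ]
            WithLp 2 (EuclideanSpace ℝ (Fin (n - 1)) × ℝ))
        (r h : ℝ) (K : ℝ≥0) (φ : EuclideanSpace ℝ (Fin (n - 1)) → ℝ),
        0 < r ∧ 0 < h ∧ T z = 0 ∧
        HolderOnWith K α φ (Metric.ball 0 r) ∧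
        ∀ x, ‖(T x).fst‖ < r → |(T x).snd| < h → (x ∈ Ω ↔ (T x).snd < φ (T x).fst)

/-- The distance from `x` to the boundary of `Ω`. -/
noncomputable def bdryDist {n : ℕ} (Ω : Set (EuclideanSpace ℝ (Fin n)))
    (x : EuclideanSpace ℝ (Fin n)) : ℝ :=
  Metric.infDist x (frontier Ω)

/-- The measure `d(x)^γ dx` on `Ω`, with `d` the distance to the boundary; the weighted space
`L^p(Ω, d^γ)` is the `L^p` space of this measure. -/
noncomputable def distMeasure {n : ℕ} (Ω : Set (EuclideanSpace ℝ (Fin n))) (γ : ℝ) :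
    Measure (EuclideanSpace ℝ (Fin n)) :=
  (volume.restrict Ω).withDensity fun x => ENNReal.ofReal (bdryDist Ω x ^ γ)

/-- `G` is the weak (distributional) gradient of `f` on the open set `Ω`: both are locally
integrable on `Ω` and `∫_Ω f ∂ᵢψ = - ∫_Ω Gᵢ ψ` for all `i` and all `ψ ∈ C_c^∞(Ω)`. -/
def IsWeakGradient {n : ℕ} (Ω : Set (EuclideanSpace ℝ (Fin n)))
    (f : EuclideanSpace ℝ (Fin n) → ℝ)
    (G : EuclideanSpace ℝ (Fin n) → EuclideanSpace ℝ (Fin n)) : Prop :=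
  LocallyIntegrableOn f Ω ∧ LocallyIntegrableOn G Ω ∧
    ∀ ψ : EuclideanSpace ℝ (Fin n) → ℝ,
      ContDiff ℝ ∞ ψ → HasCompactSupport ψ → tsupport ψ ⊆ Ω →
      ∀ i : Fin n,
        ∫ x in Ω, f x * fderiv ℝ ψ x (EuclideanSpace.single i 1) = - ∫ x in Ω, G x i * ψ x

/-! Write γ = βp and let d be the distance to ∂Ω. The inequality combines a Hardy inequality near ∂Ω
with a Poincaré inequality in the interior.

Near a boundary point Ω lies below a Hölder graph, and two facts hold along vertical lines: the
depth below the graph is at most C d^α, and d is almost decreasing upwards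
(`IsHolderDomain.exists_chart`). Since γ/α > -1, they give ∫_s^b d^γ ≤ M d(s)^γ d(s)^α for segments
[s, b] below the graph (`exists_integral_rpow_le`). This is the hypothesis of a one-dimensional
Hardy inequality (`integral_weight_mul_rpow_le`), in which each derivative costs a factor d^α; hence
the weight d^(γ+αp) on the gradient. Integration over the lines and compactness of ∂Ω bound ∫_Ω d^γ
|f|^p by the gradient term plus an integral over a compact K ⊆ Ω (`IsHolderDomain.exists_hardy`).

On K the weights are harmless. Poincaré inequalities on small balls, chained through overlaps,
control the oscillation of f between a fixed set A and K (`exists_oscBound_isCompact`); subtracting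
f(y) for a well chosen y ∈ A then controls the K term. Finally d^γ dx is a finite measure, so for
mean zero f the subtracted constant costs only a factor 2.

Weak gradients are handled by mollification on compact sets, with bounds that survive the limit by
Fatou's lemma. -/

open Filter Topology Metric Convolution

/-! ### Jensen's inequality and mollification of weakly differentiable functions -/

/-- **Jensen's inequality** for the average of a vector function against a probability density. -/
theorem enorm_integral_smul_rpow_le {X F : Type*} [MeasurableSpace X] {μ : Measure X}
    [NormedAddCommGroup F] [NormedSpace ℝ F] {η : X → ℝ} (hη : Integrable η μ)
    (h0 : ∀ x, 0 ≤ η x) (h1 : ∫ x, η x ∂μ = 1) {p : ℝ} (hp : 1 ≤ p) {g : X → F}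
    (hg : AEStronglyMeasurable g μ) :
    ‖∫ x, η x • g x ∂μ‖ₑ ^ p ≤ ∫⁻ x, ENNReal.ofReal (η x) * ‖g x‖ₑ ^ p ∂μ := by
  have hm : AEMeasurable (fun x => ENNReal.ofReal (η x)) μ := hη.aemeasurable.ennreal_ofReal
  have hp0 : 0 < p := by linarith
  -- For the probability measure ν, Jensen's inequality is the monotonicity of L^q norms between the
  -- exponents 1 and p.
  set ν := μ.withDensity fun x => ENNReal.ofReal (η x) with hν
  have hνu : ν univ = 1 := by
    rw [hν, withDensity_apply _ MeasurableSet.univ, Measure.restrict_univ,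
      ← ofReal_integral_eq_lintegral_ofReal hη (Eventually.of_forall h0), h1, ENNReal.ofReal_one]
  have key := eLpNorm'_le_eLpNorm'_mul_rpow_measure_univ (μ := ν) one_pos hp
    (hg.mono_ac (withDensity_absolutelyContinuous _ _))
  rw [hνu, ENNReal.one_rpow, mul_one, eLpNorm'_eq_lintegral_enorm,
    eLpNorm'_eq_lintegral_enorm] at key
  simp only [ENNReal.rpow_one, div_one] at key
  have hL : ∀ h : X → ℝ≥0∞, AEMeasurable h μ →
      ∫⁻ x, h x ∂ν = ∫⁻ x, ENNReal.ofReal (η x) * h x ∂μ := fun h hh => by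
    rw [hν, lintegral_withDensity_eq_lintegral_mul₀ hm hh]; rfl
  rw [hL _ hg.enorm, hL _ (hg.enorm.pow_const p)] at key
  calc ‖∫ x, η x • g x ∂μ‖ₑ ^ p ≤ (∫⁻ x, ENNReal.ofReal (η x) * ‖g x‖ₑ ∂μ) ^ p := by
        gcongr
        refine (enorm_integral_le_lintegral_enorm _).trans_eq (lintegral_congr fun x => ?_)
        rw [enorm_smul, Real.enorm_eq_ofReal (h0 x)]
    _ ≤ ((∫⁻ x, ENNReal.ofReal (η x) * ‖g x‖ₑ ^ p ∂μ) ^ (1 / p)) ^ p := by gcongr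
    _ = _ := by rw [← ENNReal.rpow_mul, one_div_mul_cancel hp0.ne', ENNReal.rpow_one]

/-- Weighted `L^p` bound for the convolution with a probability density supported in a ball. -/
theorem lintegral_enorm_integral_smul_rpow_le {E F : Type*} [NormedAddCommGroup E]
    [InnerProductSpace ℝ E] [FiniteDimensional ℝ E] [MeasurableSpace E] [BorelSpace E]
    [NormedAddCommGroup F] [NormedSpace ℝ F] [MeasurableSpace F] [BorelSpace F]
    [SecondCountableTopology F] {η : E → ℝ} (hη : Continuous η)
    (hηi : Integrable η) (h0 : ∀ x, 0 ≤ η x) (h1 : ∫ x, η x = 1) {δ : ℝ}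
    (hs : ∀ x, δ < ‖x‖ → η x = 0) {p : ℝ} (hp : 1 ≤ p) {g : E → F} (hg : Measurable g)
    {v₁ v₂ : E → ℝ≥0∞} (hv₁ : Measurable v₁) (hv : ∀ x y, dist x y ≤ δ → v₁ x ≤ v₂ y) :
    ∫⁻ x, v₁ x * ‖∫ y, η (x - y) • g y‖ₑ ^ p ≤ ∫⁻ y, v₂ y * ‖g y‖ₑ ^ p := by
  have hm : Measurable fun z : E × E => ENNReal.ofReal (η (z.1 - z.2)) :=
    (hη.measurable.comp (measurable_fst.sub measurable_snd)).ennreal_ofReal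
  calc ∫⁻ x, v₁ x * ‖∫ y, η (x - y) • g y‖ₑ ^ p
      ≤ ∫⁻ x, v₁ x * ∫⁻ y, ENNReal.ofReal (η (x - y)) * ‖g y‖ₑ ^ p := by
        gcongr with x
        refine enorm_integral_smul_rpow_le (hηi.comp_sub_left x) (fun y => h0 _) ?_ hp
          hg.aestronglyMeasurable
        rw [integral_sub_left_eq_self η volume x, h1]
    _ = ∫⁻ x, ∫⁻ y, v₁ x * (ENNReal.ofReal (η (x - y)) * ‖g y‖ₑ ^ p) := by
        refine lintegral_congr fun x => (lintegral_const_mul _ ?_).symm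
        exact (hm.comp measurable_prodMk_left).mul (hg.enorm.pow_const p)
    _ = ∫⁻ y, ∫⁻ x, v₁ x * (ENNReal.ofReal (η (x - y)) * ‖g y‖ₑ ^ p) := by
        refine lintegral_lintegral_swap (Measurable.aemeasurable ?_)
        exact (hv₁.comp measurable_fst).mul
          (hm.mul ((hg.comp measurable_snd).enorm.pow_const p))
    -- The kernel vanishes when |x - y| > δ, so the weight can be moved from x to y.
    _ ≤ ∫⁻ y, ∫⁻ x, ENNReal.ofReal (η (x - y)) * (v₂ y * ‖g y‖ₑ ^ p) := by
        refine lintegral_mono fun y => lintegral_mono fun x => ?_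
        by_cases hxy : dist x y ≤ δ
        · rw [mul_left_comm]
          gcongr
          exact hv x y hxy
        · rw [hs (x - y) (by rwa [← dist_eq_norm, ← not_le])]; simp
    _ = ∫⁻ y, v₂ y * ‖g y‖ₑ ^ p := by
        refine lintegral_congr fun y => ?_
        rw [lintegral_mul_const _ (show Measurable fun x => ENNReal.ofReal (η (x - y)) from
            hm.comp (measurable_prodMk_right (y := y))),
          lintegral_sub_right_eq_self (fun x => ENNReal.ofReal (η x)) y,
          ← ofReal_integral_eq_lintegral_ofReal hηi (Eventually.of_forall h0), h1]
        simp

section Approximation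

variable {n : ℕ}

local notation "𝔼" => EuclideanSpace ℝ (Fin n)

/-- On a compact set, the gradient of the mollification of `f` is the mollification of the weak
gradient of `f`. -/
theorem IsWeakGradient.fderiv_convolution {Ω : Set 𝔼} {f : 𝔼 → ℝ} {G : 𝔼 → 𝔼}
    (hfG : IsWeakGradient Ω f G) {K₁ : Set 𝔼} (hK₁ : IsCompact K₁) (hK₁Ω : K₁ ⊆ Ω)
    {η : 𝔼 → ℝ} (hη : ContDiff ℝ ∞ η) {δ : ℝ} (hs : tsupport η ⊆ closedBall 0 δ)
    {x : 𝔼} (hx : closedBall x δ ⊆ K₁) :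
    DifferentiableAt ℝ (η ⋆[ContinuousLinearMap.lsmul ℝ ℝ, volume] K₁.indicator f) x ∧
      ∀ v, fderiv ℝ (η ⋆[ContinuousLinearMap.lsmul ℝ ℝ, volume] K₁.indicator f) x v =
        inner ℝ (∫ y, η (x - y) • K₁.indicator G y) v := by
  have hcη : HasCompactSupport η :=
    (isCompact_closedBall 0 δ).of_isClosed_subset (isClosed_tsupport η) hs
  have hf1 : Integrable (K₁.indicator f) :=
    (integrable_indicator_iff hK₁.measurableSet).2 (hfG.1.integrableOn_compact_subset hK₁Ω hK₁)
  have hG1 : Integrable (K₁.indicator G) :=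
    (integrable_indicator_iff hK₁.measurableSet).2
      (hfG.2.1.integrableOn_compact_subset hK₁Ω hK₁)
  have hη1 : ContDiff ℝ 1 η := hη.of_le (by exact_mod_cast le_top)
  have hD := hcη.hasFDerivAt_convolution_left (ContinuousLinearMap.lsmul ℝ ℝ) hη1
    hf1.locallyIntegrable x
  refine ⟨hD.differentiableAt, fun v => ?_⟩
  rw [hD.fderiv]
  have hex := (hcη.fderiv (𝕜 := ℝ)).convolutionExists_left
    (ContinuousLinearMap.precompL 𝔼 (ContinuousLinearMap.lsmul ℝ ℝ : ℝ →L[ℝ] ℝ →L[ℝ] ℝ))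
    (hη1.continuous_fderiv one_ne_zero) hf1.locallyIntegrable x
  have hηb : Continuous fun y => η (x - y) := hη.continuous.comp (continuous_const.sub continuous_id)
  obtain ⟨M, hM⟩ := hcη.exists_bound_of_continuous hη.continuous
  have hG2 : Integrable fun y => η (x - y) • K₁.indicator G y :=
    hG1.bdd_smul M hηb.aestronglyMeasurable (Eventually.of_forall fun y => hM _)
  have hpt : ∀ v, (fderiv ℝ η ⋆[ContinuousLinearMap.precompL 𝔼 (ContinuousLinearMap.lsmul ℝ ℝ),
      volume] K₁.indicator f) x v = ∫ y, fderiv ℝ η (x - y) v * K₁.indicator f y := by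
    intro v
    rw [convolution_eq_swap, ContinuousLinearMap.integral_apply hex.integrable_swap]
    rfl
  -- The reflected kernel is the test function. Its support lies in the ball around x, hence in K₁,
  -- so it does not see the cut-off of f and G; the sign from the reflection cancels the one in the
  -- weak gradient.
  set ψ : 𝔼 → ℝ := fun y => η (x - y) with hψ
  have hψs : tsupport ψ ⊆ closedBall x δ := by
    refine closure_minimal (fun y hy => ?_) isClosed_closedBall
    have := hs (subset_tsupport η hy)
    rwa [mem_closedBall_zero_iff, ← dist_eq_norm, dist_comm] at this
  have hψd : ∀ y v, fderiv ℝ ψ y v = -fderiv ℝ η (x - y) v := by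
    intro y v
    have h1 : HasFDerivAt ψ _ y := ((hη1.differentiable one_ne_zero) (x - y)).hasFDerivAt.comp y
      ((hasFDerivAt_id y).const_sub x)
    rw [h1.fderiv]
    simp
  have hbasis : ∀ i : Fin n, ∫ y, fderiv ℝ η (x - y) (EuclideanSpace.single i 1) *
      K₁.indicator f y = (∫ y, ψ y • K₁.indicator G y) i := by
    intro i
    have hout : ∀ y, y ∉ K₁ → ψ y = 0 := fun y hy =>
      image_eq_zero_of_notMem_tsupport fun h => hy (hx (hψs h))
    have hout' : ∀ y, y ∉ K₁ → fderiv ℝ η (x - y) (EuclideanSpace.single i 1) = 0 := by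
      intro y hy
      have : fderiv ℝ ψ y = 0 := image_eq_zero_of_notMem_tsupport fun h =>
        hy (hx (hψs (tsupport_fderiv_subset ℝ h)))
      rw [← neg_eq_zero, ← hψd, this]
      simp
    have hw := hfG.2.2 ψ (hη.comp (contDiff_const.sub contDiff_id))
      ((isCompact_closedBall x δ).of_isClosed_subset (isClosed_tsupport ψ) hψs)
      (hψs.trans (hx.trans hK₁Ω)) i
    have e1 : ∫ y in Ω, f y * fderiv ℝ ψ y (EuclideanSpace.single i 1) =
        -∫ y, fderiv ℝ η (x - y) (EuclideanSpace.single i 1) * K₁.indicator f y := by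
      rw [← integral_neg, setIntegral_eq_integral_of_forall_compl_eq_zero]
      · refine integral_congr_ae (Eventually.of_forall fun y => ?_)
        by_cases hy : y ∈ K₁
        · simp only [hψd, indicator_of_mem hy]; ring
        · simp [hψd, hout' y hy]
      · intro y hy
        rw [hψd, hout' y fun h => hy (hK₁Ω h)]; simp
    have e2 : ∫ y in Ω, G y i * ψ y = (∫ y, ψ y • K₁.indicator G y) i := by
      rw [setIntegral_eq_integral_of_forall_compl_eq_zero]
      · have := (EuclideanSpace.proj (𝕜 := ℝ) i).integral_comp_comm hG2
        refine Eq.trans ?_ this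
        refine integral_congr_ae (Eventually.of_forall fun y => ?_)
        by_cases hy : y ∈ K₁
        · simp [indicator_of_mem hy, mul_comm, hψ]
        · simp [indicator_of_notMem hy, hout y hy]
      · intro y hy
        rw [hout y fun h => hy (hK₁Ω h)]; simp
    rw [e1, e2] at hw
    exact neg_injective hw
  have hlin : ((fderiv ℝ η ⋆[ContinuousLinearMap.precompL 𝔼 (ContinuousLinearMap.lsmul ℝ ℝ),
      volume] K₁.indicator f) x : 𝔼 →ₗ[ℝ] ℝ) =
      (innerSL ℝ (∫ y, ψ y • K₁.indicator G y) : 𝔼 →L[ℝ] ℝ).toLinearMap := by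
    refine (EuclideanSpace.basisFun (Fin n) ℝ).toBasis.ext fun i => ?_
    have := (hpt (EuclideanSpace.single i 1)).trans (hbasis i)
    simpa [EuclideanSpace.inner_single_right] using this
  exact LinearMap.congr_fun hlin v

/-- Approximation of a weakly differentiable function by `C¹` functions near a compact set, with
weighted bounds for the approximants and their derivatives. -/
theorem IsWeakGradient.exists_approx {Ω : Set 𝔼} {f : 𝔼 → ℝ} {G : 𝔼 → 𝔼}
    (hfG : IsWeakGradient Ω f G) (hf : Measurable f) (hG : Measurable G) {K : Set 𝔼}
    (hK : IsCompact K) {δ : ℝ} (hδ : 0 < δ) (hKΩ : cthickening δ K ⊆ Ω) :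
    ∃ u : ℕ → 𝔼 → ℝ, (∀ k, ContDiff ℝ 1 (u k)) ∧
      (∀ᵐ x, x ∈ K → Tendsto (fun k => u k x) atTop (𝓝 (f x))) ∧
      ∀ p : ℝ, 1 ≤ p → ∀ v₁ v₂ : 𝔼 → ℝ≥0∞, Measurable v₁ →
        (∀ x ∈ K, ∀ y, dist x y ≤ δ → v₁ x ≤ v₂ y) → ∀ k,
        ∫⁻ x in K, v₁ x * ‖u k x‖ₑ ^ p ≤ ∫⁻ x in Ω, v₂ x * ‖f x‖ₑ ^ p ∧
        ∫⁻ x in K, v₁ x * ‖fderiv ℝ (u k) x‖ₑ ^ p ≤ ∫⁻ x in Ω, v₂ x * ‖G x‖ₑ ^ p := by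
  set K₁ := cthickening δ K with hK₁d
  have hK₁ : IsCompact K₁ := hK.cthickening
  have hKK₁ : ∀ x ∈ K, closedBall x δ ⊆ K₁ := fun x hx =>
    closedBall_subset_cthickening hx δ
  have hf1 : Integrable (K₁.indicator f) :=
    (integrable_indicator_iff hK₁.measurableSet).2 (hfG.1.integrableOn_compact_subset hKΩ hK₁)
  -- The radii shrink to 0 at the fixed ratio 2, as required for almost everywhere convergence of
  -- the mollifications.
  let φ : ℕ → ContDiffBump (0 : 𝔼) := fun k =>
    ⟨δ / (k + 1) / 2, δ / (k + 1), by positivity, half_lt_self (by positivity)⟩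
  have hφδ : ∀ k, (φ k).rOut ≤ δ := fun k =>
    div_le_self hδ.le (by linarith [(Nat.cast_nonneg k : (0 : ℝ) ≤ k)])
  have hφs : ∀ k, tsupport ((φ k).normed volume) ⊆ closedBall 0 δ := fun k => by
    rw [(φ k).tsupport_normed_eq]
    exact closedBall_subset_closedBall (hφδ k)
  refine ⟨fun k => (φ k).normed volume ⋆[ContinuousLinearMap.lsmul ℝ ℝ, volume] K₁.indicator f,
    fun k => ?_, ?_, fun p hp v₁ v₂ hv₁ hv k => ⟨?_, ?_⟩⟩
  · exact (φ k).hasCompactSupport_normed.contDiff_convolution_left _ (φ k).contDiff_normed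
      hf1.locallyIntegrable
  · have hlim : Tendsto (fun k => (φ k).rOut) atTop (𝓝 0) := by
      refine ((tendsto_const_div_atTop_nhds_zero_nat δ).comp (tendsto_add_atTop_nat 1)).congr
        fun k => ?_
      simp [φ]
    filter_upwards [ContDiffBump.ae_convolution_tendsto_right_of_locallyIntegrable (K := 2) hlim
      (Eventually.of_forall fun k => by
        change δ / (k + 1) ≤ 2 * (δ / (k + 1) / 2); linarith) hf1.locallyIntegrable] with x hx hxK
    rwa [indicator_of_mem (self_subset_cthickening K hxK)] at hx
  all_goals
    have hext : ∀ x, δ < ‖x‖ → (φ k).normed volume x = 0 := fun x hx =>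
      image_eq_zero_of_notMem_tsupport fun h => by
        have := hφs k h
        rw [mem_closedBall_zero_iff] at this
        linarith
    have hind : ∀ x y, dist x y ≤ δ → K.indicator v₁ x ≤ Ω.indicator v₂ y := by
      intro x y hxy
      by_cases hx : x ∈ K
      · have hy : y ∈ Ω := hKΩ (hKK₁ x hx (by rwa [mem_closedBall, dist_comm]))
        rw [indicator_of_mem hx, indicator_of_mem hy]
        exact hv x hx y hxy
      · rw [indicator_of_notMem hx]; exact zero_le
    have hbound : ∀ {F : Type} [NormedAddCommGroup F] [NormedSpace ℝ F] [MeasurableSpace F]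
        [BorelSpace F] [SecondCountableTopology F] (g : 𝔼 → F), Measurable g →
        ∫⁻ x in K, v₁ x * ‖∫ y, (φ k).normed volume (x - y) • K₁.indicator g y‖ₑ ^ p ≤
          ∫⁻ x in Ω, v₂ x * ‖g x‖ₑ ^ p := by
      intro F _ _ _ _ _ g hg
      have := lintegral_enorm_integral_smul_rpow_le (φ k).continuous_normed
        (φ k).integrable_normed (φ k).nonneg_normed (φ k).integral_normed hext hp
        (hg.indicator hK₁.measurableSet) (hv₁.indicator hK.measurableSet) hind
      refine le_trans ?_ (this.trans (le_trans ?_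
        (lintegral_indicator_le (fun x => v₂ x * ‖g x‖ₑ ^ p) Ω)))
      · rw [← lintegral_indicator hK.measurableSet]
        refine lintegral_mono fun x => ?_
        by_cases hx : x ∈ K <;> simp [hx]
      · refine lintegral_mono fun x => ?_
        by_cases hx : x ∈ Ω
        · simp only [indicator_of_mem hx]
          gcongr
          exact enorm_indicator_le_enorm_self g x
        · simp [hx]
  · refine le_trans (le_of_eq (lintegral_congr fun x => ?_)) (hbound f hf)
    beta_reduce
    rw [convolution_eq_swap]
    rfl
  · refine le_trans (setLIntegral_mono' hK.measurableSet fun x hx => ?_) (hbound G hG)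
    gcongr
    rw [enorm_le_iff_norm_le]
    refine ContinuousLinearMap.opNorm_le_bound _ (norm_nonneg _) fun v => ?_
    rw [(hfG.fderiv_convolution hK₁ hKΩ (φ k).contDiff_normed (hφs k) (hKK₁ x hx)).2 v]
    exact norm_inner_le_norm _ _

end Approximation

/-- A bound for the integrals of a sequence passes to the almost everywhere limit. -/
theorem lintegral_le_of_ae_tendsto {X : Type*} [MeasurableSpace X] {μ : Measure X}
    {F : ℕ → X → ℝ≥0∞} {g : X → ℝ≥0∞} {C : ℝ≥0∞} (hF : ∀ k, Measurable (F k))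
    (hlim : ∀ᵐ x ∂μ, Tendsto (fun k => F k x) atTop (𝓝 (g x)))
    (hC : ∀ k, ∫⁻ x, F k x ∂μ ≤ C) : ∫⁻ x, g x ∂μ ≤ C :=
  calc ∫⁻ x, g x ∂μ = ∫⁻ x, liminf (fun k => F k x) atTop ∂μ :=
        lintegral_congr_ae (hlim.mono fun _ hx => hx.liminf_eq.symm)
    _ ≤ liminf (fun k => ∫⁻ x, F k x ∂μ) atTop := lintegral_liminf_le hF
    _ ≤ C := liminf_le_of_frequently_le' (Frequently.of_forall hC)

/-! ### Poincaré inequality on bounded convex sets -/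

section ConvexPoincare

variable {E : Type*} [NormedAddCommGroup E] [InnerProductSpace ℝ E]

/-- The fundamental theorem of calculus on the segment from x to x + h, followed by Jensen's
inequality on (0, 1]. -/
theorem enorm_sub_rpow_le_lintegral_fderiv {u : E → ℝ} (hu : ContDiff ℝ 1 u) {p : ℝ} (hp : 1 ≤ p)
    (x h : E) :
    ‖u x - u (x + h)‖ₑ ^ p ≤
      ‖h‖ₑ ^ p * ∫⁻ t in Ioc (0 : ℝ) 1, ‖fderiv ℝ u (x + t • h)‖ₑ ^ p := by
  have hc : Continuous fun t : ℝ => fderiv ℝ u (x + t • h) :=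
    (hu.continuous_fderiv one_ne_zero).comp (by fun_prop)
  have hg : Continuous fun t : ℝ => fderiv ℝ u (x + t • h) h := hc.clm_apply continuous_const
  have hFTC : ∫ t in (0 : ℝ)..1, fderiv ℝ u (x + t • h) h = u (x + h) - u x := by
    have := intervalIntegral.integral_eq_sub_of_hasDerivAt (a := 0) (b := 1)
      (f := fun t : ℝ => u (x + t • h)) (f' := fun t : ℝ => fderiv ℝ u (x + t • h) h)
      (fun t _ => by
        have h1 : HasDerivAt (fun t : ℝ => x + t • h) h t := by
          simpa using ((hasDerivAt_id t).smul_const h).const_add x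
        exact ((hu.differentiable one_ne_zero) _).hasFDerivAt.comp_hasDerivAt t h1)
      (hg.intervalIntegrable _ _)
    simpa using this
  have hprob : ∫ _ in Ioc (0 : ℝ) 1, (1 : ℝ) = 1 := by simp
  have hJ := enorm_integral_smul_rpow_le (μ := volume.restrict (Ioc (0 : ℝ) 1))
    (η := fun _ => (1 : ℝ)) (integrable_const 1) (fun _ => zero_le_one) hprob hp
    hg.aestronglyMeasurable
  rw [enorm_sub_rev, ← hFTC, intervalIntegral.integral_of_le zero_le_one]
  simp only [one_smul, ENNReal.ofReal_one, one_mul] at hJ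
  refine hJ.trans ?_
  rw [← lintegral_const_mul _ (hc.measurable.enorm.pow_const p)]
  gcongr with t
  rw [← ENNReal.mul_rpow_of_nonneg _ _ (by linarith), mul_comm]
  gcongr
  exact ContinuousLinearMap.le_opENorm _ _

/-- The `L^p` **Poincaré inequality** on a bounded convex set, for `C¹` functions. -/
theorem Convex.lintegral_lintegral_enorm_sub_rpow_le [FiniteDimensional ℝ E]
    [MeasurableSpace E] [BorelSpace E] {B : Set E} (hB : Convex ℝ B)
    (hBm : MeasurableSet B) {R : ℝ} (hR : ∀ x ∈ B, ∀ y ∈ B, dist x y ≤ R)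
    {u : E → ℝ} (hu : ContDiff ℝ 1 u) {p : ℝ} (hp : 1 ≤ p) :
    ∫⁻ x in B, ∫⁻ y in B, ‖u x - u y‖ₑ ^ p ≤
      ENNReal.ofReal R ^ p * volume (closedBall (0 : E) R) *
        ∫⁻ x in B, ‖fderiv ℝ u x‖ₑ ^ p := by
  have hp0 : 0 ≤ p := by linarith
  -- Extended by zero, the gradient can be integrated over the whole space, where translation by t •
  -- h does not change the integral. Convexity keeps the segments inside B, so nothing is lost.
  set D : E → ℝ≥0∞ := B.indicator fun x => ‖fderiv ℝ u x‖ₑ ^ p with hD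
  have hDm : Measurable D :=
    ((hu.continuous_fderiv one_ne_zero).measurable.enorm.pow_const p).indicator hBm
  have hF : Measurable fun q : (E × E) × ℝ => D (q.1.1 + q.2 • q.1.2) :=
    hDm.comp (by fun_prop)
  have hF2 : Measurable fun q : E × E => ∫⁻ t in Ioc (0 : ℝ) 1, D (q.1 + t • q.2) :=
    hF.lintegral_prod_right'
  have hx : ∀ x ∈ B, ∫⁻ y in B, ‖u x - u y‖ₑ ^ p ≤
      ENNReal.ofReal R ^ p * ∫⁻ h in closedBall (0 : E) R, ∫⁻ t in Ioc (0 : ℝ) 1, D (x + t • h) := by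
    intro x hx
    rw [← lintegral_indicator hBm, ← lintegral_add_left_eq_self _ x,
      ← lintegral_const_mul _ (show Measurable fun h => ∫⁻ t in Ioc (0 : ℝ) 1, D (x + t • h) from
        hF2.comp measurable_prodMk_left),
      ← lintegral_indicator measurableSet_closedBall]
    refine lintegral_mono fun h => ?_
    by_cases hxh : x + h ∈ B
    · have hh : ‖h‖ ≤ R := by simpa using hR (x + h) hxh x hx
      rw [indicator_of_mem hxh, indicator_of_mem (by simpa using hh)]
      refine (enorm_sub_rpow_le_lintegral_fderiv hu hp x h).trans ?_
      gcongr ?_ ^ p * ?_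
      · rw [← ofReal_norm]; gcongr
      · refine setLIntegral_mono' measurableSet_Ioc fun t ht => ?_
        have : x + t • h ∈ B := hB.add_smul_mem hx hxh ⟨ht.1.le, ht.2⟩
        rw [hD, indicator_of_mem this]
    · rw [indicator_of_notMem hxh]
      exact zero_le
  calc ∫⁻ x in B, ∫⁻ y in B, ‖u x - u y‖ₑ ^ p
      ≤ ∫⁻ x in B, ENNReal.ofReal R ^ p *
          ∫⁻ h in closedBall (0 : E) R, ∫⁻ t in Ioc (0 : ℝ) 1, D (x + t • h) :=
        setLIntegral_mono' hBm hx
    _ ≤ ∫⁻ x, ENNReal.ofReal R ^ p *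
          ∫⁻ h in closedBall (0 : E) R, ∫⁻ t in Ioc (0 : ℝ) 1, D (x + t • h) :=
        setLIntegral_le_lintegral _ _
    _ = ENNReal.ofReal R ^ p * ∫⁻ x, ∫⁻ h in closedBall (0 : E) R,
          ∫⁻ t in Ioc (0 : ℝ) 1, D (x + t • h) := lintegral_const_mul _ hF2.lintegral_prod_right'
    _ = ENNReal.ofReal R ^ p * ∫⁻ h in closedBall (0 : E) R, ∫⁻ x,
          ∫⁻ t in Ioc (0 : ℝ) 1, D (x + t • h) := by
        rw [lintegral_lintegral_swap hF2.aemeasurable]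
    _ = ENNReal.ofReal R ^ p * ∫⁻ h in closedBall (0 : E) R,
          ∫⁻ t in Ioc (0 : ℝ) 1, ∫⁻ x, D (x + t • h) := by
        congr 1
        refine lintegral_congr fun h => ?_
        refine lintegral_lintegral_swap (Measurable.aemeasurable ?_)
        exact hDm.comp (by fun_prop)
    _ = _ := by
        have : ∀ a : E, ∫⁻ x, D (x + a) = ∫⁻ x in B, ‖fderiv ℝ u x‖ₑ ^ p := fun a => by
          rw [lintegral_add_right_eq_self D a, hD, lintegral_indicator hBm]
        simp_rw [this]
        simp [mul_comm, mul_left_comm]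

end ConvexPoincare

/-! ### Chaining: Poincaré inequality on compact subsets of a connected open set -/

section Oscillation

variable {n : ℕ}

local notation "𝔼" => EuclideanSpace ℝ (Fin n)

/-- The oscillation of weakly differentiable functions between the sets `A` and `B` is controlled
by the weighted `L^p` norm of their gradients. -/
def OscBound (Ω : Set 𝔼) (v : 𝔼 → ℝ≥0∞) (p : ℝ) (A B : Set 𝔼) : Prop :=
  ∃ C : ℝ≥0, ∀ (f : 𝔼 → ℝ) (G : 𝔼 → 𝔼), Measurable f → Measurable G → IsWeakGradient Ω f G →
    ∫⁻ x in A, ∫⁻ y in B, ‖f x - f y‖ₑ ^ p ≤ C * ∫⁻ x in Ω, v x * ‖G x‖ₑ ^ p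

variable {Ω : Set (EuclideanSpace ℝ (Fin n))} {v : EuclideanSpace ℝ (Fin n) → ℝ≥0∞} {p : ℝ}

theorem OscBound.mono {A A' B B' : Set 𝔼} (h : OscBound Ω v p A B) (hA : A' ⊆ A) (hB : B' ⊆ B) :
    OscBound Ω v p A' B' := by
  obtain ⟨C, hC⟩ := h
  refine ⟨C, fun f G hf hG hfG => le_trans ?_ (hC f G hf hG hfG)⟩
  exact (lintegral_mono_set hA).trans (lintegral_mono fun x => lintegral_mono_set hB)

theorem measurable_enorm_sub_rpow {f : 𝔼 → ℝ} (hf : Measurable f) :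
    Measurable fun q : 𝔼 × 𝔼 => ‖f q.1 - f q.2‖ₑ ^ p :=
  ((hf.comp measurable_fst).sub (hf.comp measurable_snd)).enorm.pow_const p

theorem OscBound.union {A B B' : Set 𝔼} (h : OscBound Ω v p A B) (h' : OscBound Ω v p A B') :
    OscBound Ω v p A (B ∪ B') := by
  obtain ⟨C, hC⟩ := h
  obtain ⟨C', hC'⟩ := h'
  refine ⟨C + C', fun f G hf hG hfG => ?_⟩
  calc ∫⁻ x in A, ∫⁻ y in B ∪ B', ‖f x - f y‖ₑ ^ p
      ≤ ∫⁻ x in A, ((∫⁻ y in B, ‖f x - f y‖ₑ ^ p) + ∫⁻ y in B', ‖f x - f y‖ₑ ^ p) :=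
        lintegral_mono fun x => lintegral_union_le _ _ _
    _ = (∫⁻ x in A, ∫⁻ y in B, ‖f x - f y‖ₑ ^ p) + ∫⁻ x in A, ∫⁻ y in B', ‖f x - f y‖ₑ ^ p :=
        lintegral_add_left (measurable_enorm_sub_rpow hf).lintegral_prod_right' _
    _ ≤ _ := by
        push_cast
        rw [add_mul]
        exact add_le_add (hC f G hf hG hfG) (hC' f G hf hG hfG)

/-- Compare f x and f y through f z, and average over z in the overlap `B ∩ B'`, which has positive
measure. -/
theorem OscBound.trans {A B B' D : Set 𝔼} (hp : 1 ≤ p) (h : OscBound Ω v p A B)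
    (h' : OscBound Ω v p B' D) (hA : volume A ≠ ⊤) (hD : volume D ≠ ⊤)
    (hBB' : volume (B ∩ B') ≠ 0) (hB : volume B ≠ ⊤) : OscBound Ω v p A D := by
  set S := B ∩ B' with hS
  have hSt : volume S ≠ ⊤ := measure_ne_top_of_subset inter_subset_left hB
  obtain ⟨C, hC⟩ := h.mono Subset.rfl (inter_subset_left : S ⊆ B)
  obtain ⟨C', hC'⟩ := h'.mono (inter_subset_right : S ⊆ B') Subset.rfl
  have h2t : (2 : ℝ≥0∞) ^ (p - 1) ≠ ⊤ := ENNReal.rpow_ne_top_of_nonneg (by linarith) (by simp)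
  have hfin : (volume S)⁻¹ * (2 ^ (p - 1) * (volume D * C + volume A * C')) ≠ ⊤ := by
    finiteness
  refine ⟨((volume S)⁻¹ * (2 ^ (p - 1) * (volume D * C + volume A * C'))).toNNReal,
    fun f G hf hG hfG => ?_⟩
  rw [ENNReal.coe_toNNReal hfin]
  set I := ∫⁻ x in Ω, v x * ‖G x‖ₑ ^ p
  have hm := measurable_enorm_sub_rpow (p := p) hf
  have key : volume S * ∫⁻ x in A, ∫⁻ y in D, ‖f x - f y‖ₑ ^ p ≤
      2 ^ (p - 1) * (volume D * C + volume A * C') * I := by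
    calc volume S * ∫⁻ x in A, ∫⁻ y in D, ‖f x - f y‖ₑ ^ p
        = ∫⁻ x in A, ∫⁻ y in D, ∫⁻ _ in S, ‖f x - f y‖ₑ ^ p := by
          simp_rw [setLIntegral_const]
          rw [← lintegral_const_mul _ hm.lintegral_prod_right']
          refine lintegral_congr fun x => ?_
          rw [lintegral_mul_const' _ _ hSt, mul_comm]
      _ ≤ ∫⁻ x in A, ∫⁻ y in D, ∫⁻ z in S,
            2 ^ (p - 1) * (‖f x - f z‖ₑ ^ p + ‖f z - f y‖ₑ ^ p) := by
          gcongr with x y z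
          refine le_trans ?_ (ENNReal.rpow_add_le_mul_rpow_add_rpow _ _ hp)
          gcongr
          rw [← sub_add_sub_cancel (f x) (f z) (f y)]
          exact enorm_add_le _ _
      _ = ∫⁻ x in A, ∫⁻ y in D, 2 ^ (p - 1) *
            ((∫⁻ z in S, ‖f x - f z‖ₑ ^ p) + ∫⁻ z in S, ‖f z - f y‖ₑ ^ p) := by
          refine lintegral_congr fun x => lintegral_congr fun y => ?_
          have h1 : Measurable fun z => ‖f x - f z‖ₑ ^ p := hm.comp measurable_prodMk_left
          rw [lintegral_const_mul' _ _ h2t, lintegral_add_left h1]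
      _ = ∫⁻ x in A, 2 ^ (p - 1) * (volume D * (∫⁻ z in S, ‖f x - f z‖ₑ ^ p) +
            ∫⁻ z in S, ∫⁻ y in D, ‖f z - f y‖ₑ ^ p) := by
          refine lintegral_congr fun x => ?_
          rw [lintegral_const_mul' _ _ h2t,
            lintegral_add_left measurable_const, setLIntegral_const, mul_comm (volume D),
            lintegral_lintegral_swap (μ := volume.restrict D) (ν := volume.restrict S)
              (f := fun y z => ‖f z - f y‖ₑ ^ p) (hm.comp measurable_swap).aemeasurable]
      _ = 2 ^ (p - 1) * (volume D * (∫⁻ x in A, ∫⁻ z in S, ‖f x - f z‖ₑ ^ p) +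
            volume A * ∫⁻ z in S, ∫⁻ y in D, ‖f z - f y‖ₑ ^ p) := by
          have h1 : Measurable fun x => ∫⁻ z in S, ‖f x - f z‖ₑ ^ p := hm.lintegral_prod_right'
          rw [lintegral_const_mul' _ _ h2t,
            lintegral_add_left (h1.const_mul _), lintegral_const_mul _ h1, setLIntegral_const,
            mul_comm (volume A)]
      _ ≤ 2 ^ (p - 1) * (volume D * (C * I) + volume A * (C' * I)) := by
          gcongr
          · exact hC f G hf hG hfG
          · exact hC' f G hf hG hfG
      _ = _ := by ring
  rw [mul_assoc]
  calc _ = (volume S)⁻¹ * (volume S * ∫⁻ x in A, ∫⁻ y in D, ‖f x - f y‖ₑ ^ p) := by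
        rw [← mul_assoc, ENNReal.inv_mul_cancel hBB' hSt, one_mul]
    _ ≤ _ := by gcongr

/-- On a small ball the weight is bounded below, so the convex Poincaré inequality for the mollified
functions passes to the limit. -/
theorem exists_oscBound_ball (hΩ : IsOpen Ω) (hp : 1 ≤ p)
    (hv : ∀ z ∈ Ω, ∃ c : ℝ≥0, c ≠ 0 ∧ ∀ᶠ y in 𝓝 z, (c : ℝ≥0∞) ≤ v y) {z : 𝔼} (hz : z ∈ Ω) :
    ∃ r > 0, ball z r ⊆ Ω ∧ OscBound Ω v p (ball z r) (ball z r) := by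
  obtain ⟨c, hc0, hc⟩ := hv z hz
  obtain ⟨R, hR, hRs⟩ := nhds_basis_closedBall.mem_iff.1 (hc.and (hΩ.mem_nhds hz))
  -- Halving leaves room to mollify at scale r without leaving the ball of radius R.
  set r := R / 2 with hr
  have hr0 : 0 < r := by positivity
  have hrr : r + r = R := by rw [hr]; ring
  set M := ENNReal.ofReal (2 * r) ^ p * volume (closedBall (0 : 𝔼) (2 * r)) with hM
  have hMt : M ≠ ⊤ := by
    have : ENNReal.ofReal (2 * r) ^ p ≠ ⊤ :=
      ENNReal.rpow_ne_top_of_nonneg (by linarith) ENNReal.ofReal_ne_top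
    have := (isCompact_closedBall (0 : 𝔼) (2 * r)).measure_ne_top (μ := volume)
    finiteness
  refine ⟨r, hr0, fun y hy => (hRs (ball_subset_closedBall
    (ball_subset_ball (by linarith) hy))).2, (M * (c : ℝ≥0∞)⁻¹).toNNReal, fun f G hf hG hfG => ?_⟩
  rw [ENNReal.coe_toNNReal (ENNReal.mul_ne_top hMt (by simpa using hc0))]
  obtain ⟨u, hu, hlim, hbd⟩ := hfG.exists_approx hf hG (isCompact_closedBall z r) hr0
    (by rw [cthickening_closedBall hr0.le hr0.le, hrr]; exact fun y hy => (hRs hy).2)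
  have hlim' : ∀ᵐ x ∂volume.restrict (ball z r), Tendsto (fun k => u k x) atTop (𝓝 (f x)) := by
    rw [ae_restrict_iff' measurableSet_ball]
    exact hlim.mono fun x hx hxb => hx (ball_subset_closedBall hxb)
  rw [lintegral_lintegral (measurable_enorm_sub_rpow hf).aemeasurable]
  refine lintegral_le_of_ae_tendsto (F := fun k q => ‖u k q.1 - u k q.2‖ₑ ^ p)
    (fun k => measurable_enorm_sub_rpow (hu k).continuous.measurable)
    ?_ fun k => ?_
  · filter_upwards [Measure.quasiMeasurePreserving_fst.ae hlim',
      Measure.quasiMeasurePreserving_snd.ae hlim'] with q h1 h2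
    exact ((ENNReal.continuous_rpow_const.comp continuous_enorm).tendsto _).comp (h1.sub h2)
  · rw [← lintegral_lintegral (f := fun x y => ‖u k x - u k y‖ₑ ^ p)
      (measurable_enorm_sub_rpow (hu k).continuous.measurable).aemeasurable]
    refine ((convex_ball z r).lintegral_lintegral_enorm_sub_rpow_le measurableSet_ball
      (R := 2 * r) (fun x hx y hy => ?_) (hu k) hp).trans ?_
    · have := dist_triangle_right x y z
      rw [mem_ball] at hx hy
      linarith
    · rw [mul_assoc M]
      refine mul_le_mul_right ?_ M
      have := (hbd p hp (fun _ => c) v measurable_const (fun x hx y hxy => ?_) k).2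
      · have hmD := (((hu k).continuous_fderiv one_ne_zero).measurable.enorm.pow_const p)
        rw [lintegral_const_mul _ hmD] at this
        calc ∫⁻ x in ball z r, ‖fderiv ℝ (u k) x‖ₑ ^ p
            ≤ ∫⁻ x in closedBall z r, ‖fderiv ℝ (u k) x‖ₑ ^ p :=
              lintegral_mono_set ball_subset_closedBall
          _ = (c : ℝ≥0∞)⁻¹ * (c * ∫⁻ x in closedBall z r, ‖fderiv ℝ (u k) x‖ₑ ^ p) := by
              rw [← mul_assoc, ENNReal.inv_mul_cancel (by simpa using hc0) (by simp), one_mul]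
          _ ≤ _ := by gcongr
      · refine (hRs ?_).1
        have := dist_triangle y x z
        rw [mem_closedBall] at hx ⊢
        rw [dist_comm y x] at this
        linarith

/-- **Poincaré inequality** for compact subsets of a connected open set. -/
theorem exists_oscBound_isCompact (hΩ : IsOpen Ω) (hΩc : IsConnected Ω) (hp : 1 ≤ p)
    (hv : ∀ z ∈ Ω, ∃ c : ℝ≥0, c ≠ 0 ∧ ∀ᶠ y in 𝓝 z, (c : ℝ≥0∞) ≤ v y) :
    ∃ A : Set 𝔼, MeasurableSet A ∧ volume A ≠ 0 ∧ volume A ≠ ⊤ ∧ A ⊆ Ω ∧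
      ∀ K ⊆ Ω, IsCompact K → OscBound Ω v p A K := by
  obtain ⟨z₀, hz₀⟩ := hΩc.nonempty
  obtain ⟨r₀, hr₀, hr₀Ω, h₀⟩ := exists_oscBound_ball hΩ hp hv hz₀
  set A := ball z₀ r₀
  -- U is open by shrinking balls and relatively closed in Ω by chaining through one more ball, so
  -- connectedness gives Ω ⊆ U.
  set U : Set 𝔼 := {z | ∃ ε > 0, OscBound Ω v p A (ball z ε)} with hU
  have hUo : IsOpen U := by
    refine isOpen_iff.2 fun z ⟨ε, hε, h⟩ => ⟨ε, hε, fun z' hz' => ?_⟩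
    exact ⟨ε - dist z' z, sub_pos.2 hz', h.mono Subset.rfl (ball_subset_ball' (by linarith))⟩
  have hΩU : Ω ⊆ U := by
    refine hΩc.isPreconnected.subset_of_closure_inter_subset hUo ⟨z₀, hz₀, r₀, hr₀, h₀⟩ ?_
    rintro z ⟨hzU, hz⟩
    obtain ⟨r, hr, hrΩ, h⟩ := exists_oscBound_ball hΩ hp hv hz
    obtain ⟨z', ⟨ε, hε, hz'⟩, hzz'⟩ := Metric.mem_closure_iff.1 hzU r hr
    refine ⟨r, hr, hz'.trans hp h measure_ball_lt_top.ne measure_ball_lt_top.ne ?_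
      measure_ball_lt_top.ne⟩
    exact ((isOpen_ball.inter isOpen_ball).measure_pos volume
      ⟨z', mem_ball_self hε, by rwa [mem_ball, dist_comm]⟩).ne'
  refine ⟨A, measurableSet_ball, (measure_ball_pos volume z₀ hr₀).ne', measure_ball_lt_top.ne,
    hr₀Ω, fun K hKΩ hK => ?_⟩
  refine hK.induction_on (p := OscBound Ω v p A) ⟨0, by simp⟩
    (fun s t hst h => h.mono Subset.rfl hst) (fun s t hs ht => hs.union ht) fun z hz => ?_
  obtain ⟨ε, hε, h⟩ := hΩU (hKΩ hz)
  exact ⟨ball z ε, mem_nhdsWithin_of_mem_nhds (ball_mem_nhds z hε), h⟩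

end Oscillation

/-! ### One-dimensional weighted Hardy inequalities -/

/-- Young's inequality with a parameter and without sharp constants: the larger of B and δA decides
which term on the right suffices. A small δ allows the first term to be absorbed. -/
theorem rpow_sub_one_mul_le {A B δ p : ℝ} (hA : 0 ≤ A) (hB : 0 ≤ B) (hδ : 0 < δ) (hp : 1 < p) :
    A ^ (p - 1) * B ≤ δ * A ^ p + δ ^ (1 - p) * B ^ p := by
  have hmul : ∀ {x : ℝ}, 0 ≤ x → x ^ (p - 1) * x = x ^ p := fun {x} hx => by
    rcases hx.eq_or_lt with rfl | hx
    · rw [mul_zero, Real.zero_rpow (by linarith)]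
    · rw [← Real.rpow_add_one hx.ne']; ring_nf
  have h1 : 0 ≤ δ * A ^ p := by positivity
  have h2 : 0 ≤ δ ^ (1 - p) * B ^ p := by positivity
  rcases le_total B (δ * A) with h | h
  · calc A ^ (p - 1) * B ≤ A ^ (p - 1) * (δ * A) := by gcongr
      _ = δ * A ^ p := by rw [← hmul hA]; ring
      _ ≤ _ := by linarith
  · have hAB : A ≤ δ⁻¹ * B := by rwa [inv_mul_eq_div, le_div_iff₀' hδ]
    calc A ^ (p - 1) * B ≤ (δ⁻¹ * B) ^ (p - 1) * B := by
          gcongr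
      _ = δ ^ (1 - p) * B ^ p := by
          rw [Real.mul_rpow (by positivity) hB, mul_assoc, hmul hB, Real.inv_rpow hδ.le,
            ← Real.rpow_neg hδ.le, neg_sub]
      _ ≤ _ := by linarith

/-- One-dimensional weighted **Hardy inequality**, with a boundary term. -/
theorem integral_weight_mul_rpow_le {a b M p : ℝ} (hab : a ≤ b) (hM : 0 < M) (hp : 1 < p)
    {w D g : ℝ → ℝ} (hw : ContinuousOn w (Icc a b)) (hD : ContinuousOn D (Icc a b))
    (hw0 : ∀ s ∈ Icc a b, 0 ≤ w s) (hD0 : ∀ s ∈ Icc a b, 0 ≤ D s)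
    (hW : ∀ s ∈ Icc a b, ∫ t in s..b, w t ≤ M * w s * D s) (hg : ContDiff ℝ 1 g) :
    ∫ s in a..b, w s * |g s| ^ p ≤ 2 * (M * w a * D a) * |g a| ^ p +
      (2 * p * M) ^ p * ∫ s in a..b, w s * (D s * |deriv g s|) ^ p := by
  have huab : uIcc a b = Icc a b := uIcc_of_le hab
  have hgc : Continuous g := hg.continuous
  have hg'c : Continuous (deriv g) := hg.continuous_deriv le_rfl
  have hgp : Continuous fun s => |g s| ^ p := hgc.abs.rpow_const fun s => Or.inr (by linarith)
  have hWc : ContinuousOn (fun s => ∫ t in s..b, w t) (Icc a b) := by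
    rw [← huab]
    refine intervalIntegral.continuousOn_primitive_interval_left ?_
    rw [huab]
    exact hw.integrableOn_Icc
  have hgd : ∀ s, HasDerivAt (fun s => |g s| ^ p) (p * |g s| ^ (p - 2) * g s * deriv g s) s :=
    fun s => (hasDerivAt_abs_rpow (g s) hp).comp s
      ((hg.differentiable one_ne_zero) s).hasDerivAt
  have habs : ∀ s, |p * |g s| ^ (p - 2) * g s * deriv g s| = p * (|g s| ^ (p - 1) * |deriv g s|) := by
    intro s
    have : |g s| ^ (p - 2) * |g s| = |g s| ^ (p - 1) := by
      rcases (abs_nonneg (g s)).eq_or_lt with h | h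
      · rw [← h, mul_zero, Real.zero_rpow (by linarith)]
      · rw [← Real.rpow_add_one h.ne']; ring_nf
    rw [abs_mul, abs_mul, abs_mul, abs_of_pos (by linarith : 0 < p),
      abs_of_nonneg (Real.rpow_nonneg (abs_nonneg _) _), ← this]
    ring
  have hgd' : deriv (fun s => |g s| ^ p) = fun s => p * |g s| ^ (p - 2) * g s * deriv g s :=
    funext fun s => (hgd s).deriv
  have hgpd : Continuous fun s => p * |g s| ^ (p - 2) * g s * deriv g s := by
    have h1 : ContDiff ℝ 1 fun s => ‖g s‖ ^ p := hg.norm_rpow hp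
    rw [← hgd']
    exact h1.continuous_deriv le_rfl
  have hint : ∀ {h : ℝ → ℝ}, ContinuousOn h (Icc a b) → IntervalIntegrable h volume a b :=
    fun hh => (huab ▸ hh).intervalIntegrable
  have i1 : IntervalIntegrable (fun s => w s * |g s| ^ p) volume a b := hint (hw.mul hgp.continuousOn)
  have i2 : IntervalIntegrable (fun s => (∫ t in s..b, w t) *
      (p * |g s| ^ (p - 2) * g s * deriv g s)) volume a b := hint (hWc.mul hgpd.continuousOn)
  have i3 : IntervalIntegrable (fun s => w s * (D s * |deriv g s|) ^ p) volume a b := hint (hw.mul ((hD.mul hg'c.abs.continuousOn).rpow_const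
    fun s _ => Or.inr (by linarith : (0 : ℝ) ≤ p)))
  -- Integration by parts with the primitive W(s) = ∫_s^b w, which vanishes at b; only the boundary
  -- term at a remains.
  have hparts : ∫ s in a..b, (-(w s * |g s| ^ p) +
      (∫ t in s..b, w t) * (p * |g s| ^ (p - 2) * g s * deriv g s)) =
      0 - (∫ t in a..b, w t) * |g a| ^ p := by
    have := intervalIntegral.integral_eq_sub_of_hasDerivAt_of_le hab
      (f := fun s => (∫ t in s..b, w t) * |g s| ^ p)
      (f' := fun s => -(w s * |g s| ^ p) +
        (∫ t in s..b, w t) * (p * |g s| ^ (p - 2) * g s * deriv g s))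
      (hWc.mul hgp.continuousOn) (fun s hs => ?_) (i1.neg.add i2)
    · simpa using this
    · have hnhds : Icc a b ∈ 𝓝 s := Icc_mem_nhds hs.1 hs.2
      have hWd := intervalIntegral.integral_hasDerivAt_left (a := s) (b := b) (f := w)
        ((hw.mono (by rw [uIcc_of_le hs.2.le]; exact Icc_subset_Icc_left hs.1.le)).intervalIntegrable)
        (hw.stronglyMeasurableAtFilter_nhdsWithin measurableSet_Icc s |>.filter_mono
          (by rw [nhdsWithin_eq_nhds.2 hnhds]))
        (hw.continuousAt hnhds)
      exact (hWd.mul (hgd s)).congr_deriv (by ring)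
  have i1n : IntervalIntegrable (fun s => -(w s * |g s| ^ p)) volume a b := i1.neg
  rw [intervalIntegral.integral_add i1n i2, intervalIntegral.integral_neg] at hparts
  -- Young's inequality with δ = (2pM)⁻¹ gives the term in |g|^p the coefficient 1/2. It is absorbed
  -- on the left, which doubles the other constants.
  have hle : ∫ s in a..b, (∫ t in s..b, w t) * (p * |g s| ^ (p - 2) * g s * deriv g s) ≤
      ∫ s in a..b, (2⁻¹ * (w s * |g s| ^ p) +
        2⁻¹ * (2 * p * M) ^ p * (w s * (D s * |deriv g s|) ^ p)) := by
    refine intervalIntegral.integral_mono_on hab i2 ((i1.const_mul _).add (i3.const_mul _))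
      fun s hs => ?_
    have hpos : 0 < 2 * p * M := by positivity
    have hY := rpow_sub_one_mul_le (abs_nonneg (g s))
      (mul_nonneg (hD0 s hs) (abs_nonneg (deriv g s))) (inv_pos.2 hpos) hp
    have hc : p * M * ((2 * p * M)⁻¹) ^ (1 - p) = 2⁻¹ * (2 * p * M) ^ p := by
      rw [Real.inv_rpow hpos.le, ← Real.rpow_neg hpos.le, neg_sub, Real.rpow_sub_one hpos.ne']
      field_simp
    have hc' : p * M * (2 * p * M)⁻¹ = 2⁻¹ := by field_simp
    have hWs0 : 0 ≤ ∫ t in s..b, w t :=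
      intervalIntegral.integral_nonneg hs.2 fun t ht => hw0 t ⟨hs.1.trans ht.1, ht.2⟩
    calc (∫ t in s..b, w t) * (p * |g s| ^ (p - 2) * g s * deriv g s)
        ≤ (∫ t in s..b, w t) * (p * (|g s| ^ (p - 1) * |deriv g s|)) := by
          rw [← habs]
          gcongr
          exact le_abs_self _
      _ ≤ (M * w s * D s) * (p * (|g s| ^ (p - 1) * |deriv g s|)) := by
          gcongr
          exact hW s hs
      _ = w s * (p * M * (|g s| ^ (p - 1) * (D s * |deriv g s|))) := by ring
      _ ≤ w s * (p * M * ((2 * p * M)⁻¹ * |g s| ^ p +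
            (2 * p * M)⁻¹ ^ (1 - p) * (D s * |deriv g s|) ^ p)) := by
          have := hw0 s hs
          gcongr
      _ = w s * ((p * M * (2 * p * M)⁻¹) * |g s| ^ p +
            (p * M * (2 * p * M)⁻¹ ^ (1 - p)) * (D s * |deriv g s|) ^ p) := by ring
      _ = _ := by rw [hc, hc']; ring
  rw [intervalIntegral.integral_add (i1.const_mul _) (i3.const_mul _),
    intervalIntegral.integral_const_mul, intervalIntegral.integral_const_mul] at hle
  have hWa := mul_le_mul_of_nonneg_right (hW a ⟨le_rfl, hab⟩)
    (Real.rpow_nonneg (abs_nonneg (g a)) p)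
  nlinarith [hparts, hle, hWa]

/-- One-dimensional weighted **Hardy inequality**, with an interior term. -/
theorem lintegral_weight_mul_rpow_le {a m b M p : ℝ} (ham : a < m) (hmb : m ≤ b) (hM : 0 < M)
    (hp : 1 < p) {w D g : ℝ → ℝ} (hw : ContinuousOn w (Icc a b)) (hD : ContinuousOn D (Icc a b))
    (hw0 : ∀ s ∈ Icc a b, 0 ≤ w s) (hD0 : ∀ s ∈ Icc a b, 0 ≤ D s)
    (hW : ∀ s ∈ Icc a b, ∫ t in s..b, w t ≤ M * w s * D s) (hg : ContDiff ℝ 1 g) :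
    ∫⁻ s in Icc m b, ENNReal.ofReal (w s) * ‖g s‖ₑ ^ p ≤
      ENNReal.ofReal (2 * M / (m - a)) *
        (∫⁻ s in Icc a m, ENNReal.ofReal (w s * D s) * ‖g s‖ₑ ^ p) +
      ENNReal.ofReal ((2 * p * M) ^ p) *
        ∫⁻ s in Icc a b, ENNReal.ofReal (w s * D s ^ p) * ‖deriv g s‖ₑ ^ p := by
  have hp0 : 0 ≤ p := by linarith
  have hgc : Continuous g := hg.continuous
  have hg'c : Continuous (deriv g) := hg.continuous_deriv le_rfl
  have hgp : Continuous fun s => |g s| ^ p := hgc.abs.rpow_const fun s => Or.inr hp0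
  have hen : ∀ x : ℝ, ‖x‖ₑ ^ p = ENNReal.ofReal (|x| ^ p) := fun x => by
    rw [← ofReal_norm, Real.norm_eq_abs, ENNReal.ofReal_rpow_of_nonneg (abs_nonneg _) hp0]
  have c1 : ContinuousOn (fun s => w s * |g s| ^ p) (Icc a b) := hw.mul hgp.continuousOn
  have c2 : ContinuousOn (fun s => w s * D s * |g s| ^ p) (Icc a b) :=
    (hw.mul hD).mul hgp.continuousOn
  have c3 : ContinuousOn (fun s => w s * (D s * |deriv g s|) ^ p) (Icc a b) :=
    hw.mul ((hD.mul hg'c.abs.continuousOn).rpow_const fun s _ => Or.inr hp0)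
  have hX : ∫⁻ s in Icc m b, ENNReal.ofReal (w s) * ‖g s‖ₑ ^ p =
      ENNReal.ofReal (∫ s in Icc m b, w s * |g s| ^ p) := by
    have hsub : Icc m b ⊆ Icc a b := Icc_subset_Icc_left ham.le
    rw [ofReal_integral_eq_lintegral_ofReal (c1.mono hsub).integrableOn_Icc]
    · refine setLIntegral_congr_fun measurableSet_Icc fun s hs => ?_
      simp only [hen, ENNReal.ofReal_mul (hw0 s (hsub hs))]
    · exact (ae_restrict_iff' measurableSet_Icc).2 (Eventually.of_forall fun s hs =>
        mul_nonneg (hw0 s (hsub hs)) (by positivity))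
  have hY : ∫⁻ s in Icc a b, ENNReal.ofReal (w s * D s ^ p) * ‖deriv g s‖ₑ ^ p =
      ENNReal.ofReal (∫ s in Icc a b, w s * (D s * |deriv g s|) ^ p) := by
    rw [ofReal_integral_eq_lintegral_ofReal c3.integrableOn_Icc]
    · refine setLIntegral_congr_fun measurableSet_Icc fun s hs => ?_
      have h1 := hw0 s hs
      have h2 := hD0 s hs
      simp only [hen]
      rw [← ENNReal.ofReal_mul (by positivity), Real.mul_rpow h2 (abs_nonneg _), mul_assoc]
    · exact (ae_restrict_iff' measurableSet_Icc).2 (Eventually.of_forall fun s hs => by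
        have h1 := hw0 s hs
        have h2 := hD0 s hs
        simp only [Pi.zero_apply]
        positivity)
  set X := ∫ s in Icc m b, w s * |g s| ^ p with hXd
  set Y := ∫ s in Icc a b, w s * (D s * |deriv g s|) ^ p with hYd
  -- The inequality is applied from every starting point c in [a, m]. Averaging over c turns the
  -- boundary term into an integral, with the factor 1/(m - a).
  have hpt : ∀ c ∈ Icc a m, ENNReal.ofReal X ≤
      ENNReal.ofReal (2 * M) * (ENNReal.ofReal (w c * D c) * ‖g c‖ₑ ^ p) +
        ENNReal.ofReal ((2 * p * M) ^ p) * ENNReal.ofReal Y := by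
    intro c hc
    have hcb : c ≤ b := hc.2.trans hmb
    have hsub : Icc c b ⊆ Icc a b := Icc_subset_Icc_left hc.1
    have hca : c ∈ Icc a b := ⟨hc.1, hcb⟩
    have hH := integral_weight_mul_rpow_le hcb hM hp (hw.mono hsub) (hD.mono hsub)
      (fun s hs => hw0 s (hsub hs)) (fun s hs => hD0 s (hsub hs)) (fun s hs => hW s (hsub hs)) hg
    rw [intervalIntegral.integral_of_le hcb, intervalIntegral.integral_of_le hcb,
      ← integral_Icc_eq_integral_Ioc, ← integral_Icc_eq_integral_Ioc] at hH
    have h1 : X ≤ ∫ s in Icc c b, w s * |g s| ^ p := by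
      refine setIntegral_mono_set (c1.mono hsub).integrableOn_Icc
        ((ae_restrict_iff' measurableSet_Icc).2 (Eventually.of_forall fun s hs =>
          mul_nonneg (hw0 s (hsub hs)) (by positivity)))
        (Icc_subset_Icc_left hc.2).eventuallyLE
    have h2 : ∫ s in Icc c b, w s * (D s * |deriv g s|) ^ p ≤ Y := by
      refine setIntegral_mono_set c3.integrableOn_Icc
        ((ae_restrict_iff' measurableSet_Icc).2 (Eventually.of_forall fun s hs => by
          have h1 := hw0 s hs
          have h2 := hD0 s hs
          simp only [Pi.zero_apply]
          positivity)) hsub.eventuallyLE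
    have hwc := hw0 c hca
    have hDc := hD0 c hca
    rw [hen, ← ENNReal.ofReal_mul (by positivity), ← ENNReal.ofReal_mul (by positivity),
      ← ENNReal.ofReal_mul (by positivity)]
    refine le_trans (ENNReal.ofReal_le_ofReal ?_) ENNReal.ofReal_add_le
    calc X ≤ _ := h1.trans hH
      _ ≤ 2 * (M * w c * D c) * |g c| ^ p + (2 * p * M) ^ p * Y := by gcongr
      _ = _ := by ring
  have hma : 0 < m - a := sub_pos.2 ham
  have hvol : volume (Icc a m) = ENNReal.ofReal (m - a) := Real.volume_Icc
  have hv0 : ENNReal.ofReal (m - a) ≠ 0 := by simpa using ham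
  have hsum := setLIntegral_mono' (μ := volume) measurableSet_Icc hpt
  rw [lintegral_add_right _ measurable_const, setLIntegral_const, setLIntegral_const, hvol,
    lintegral_const_mul' _ _ ENNReal.ofReal_ne_top] at hsum
  rw [hX, hY, ENNReal.ofReal_div_of_pos hma]
  refine (ENNReal.mul_le_mul_iff_left hv0 ENNReal.ofReal_ne_top).1 (hsum.trans_eq ?_)
  rw [add_mul]
  congr 1
  rw [mul_right_comm, ENNReal.div_mul_cancel hv0 ENNReal.ofReal_ne_top]

/-! ### Distance to the boundary and Cartesian coordinates -/

section BoundaryDistance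

variable {n : ℕ} {Ω : Set (EuclideanSpace ℝ (Fin n))}

theorem continuous_bdryDist : Continuous (bdryDist Ω) := continuous_infDist_pt _

theorem bdryDist_nonneg (x : EuclideanSpace ℝ (Fin n)) : 0 ≤ bdryDist Ω x := infDist_nonneg

/-- A point of the complement nearest to x ∈ Ω lies on the frontier. -/
theorem bdryDist_le_dist {x q : EuclideanSpace ℝ (Fin n)} (hx : x ∈ Ω) (hq : q ∉ Ω) :
    bdryDist Ω x ≤ dist x q := by
  obtain ⟨y, hy, hxy⟩ := exists_mem_frontier_infDist_compl_eq_dist hx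
    (fun h => hq (h ▸ mem_univ q))
  calc bdryDist Ω x ≤ dist x y := infDist_le_dist_of_mem hy
    _ = infDist x Ωᶜ := hxy.symm
    _ ≤ dist x q := infDist_le_dist_of_mem hq

theorem exists_notMem_bdryDist_eq (hΩ : IsOpen Ω) (hne : (frontier Ω).Nonempty)
    (x : EuclideanSpace ℝ (Fin n)) : ∃ q, q ∉ Ω ∧ bdryDist Ω x = dist x q := by
  obtain ⟨q, hq, h⟩ := isClosed_frontier.exists_infDist_eq_dist hne x
  exact ⟨q, fun hqΩ => (hΩ.frontier_eq ▸ hq).2 hqΩ, h⟩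

theorem bdryDist_pos (hΩ : IsOpen Ω) (hne : (frontier Ω).Nonempty)
    {x : EuclideanSpace ℝ (Fin n)} (hx : x ∈ Ω) : 0 < bdryDist Ω x := by
  obtain ⟨q, hq, h⟩ := exists_notMem_bdryDist_eq hΩ hne x
  rw [h]
  exact dist_pos.2 fun hxq => hq (hxq ▸ hx)

theorem exists_bdryDist_le (hΩb : Bornology.IsBounded Ω) (hne : (frontier Ω).Nonempty) :
    ∃ M > 0, ∀ x ∈ Ω, bdryDist Ω x ≤ M := by
  obtain ⟨z, hz⟩ := hne
  obtain ⟨M, hM⟩ := hΩb.subset_closedBall z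
  refine ⟨max M 1, by positivity, fun x hx => ?_⟩
  exact (infDist_le_dist_of_mem hz).trans ((hM hx).trans (le_max_left _ _))

end BoundaryDistance

/-- The inverse of a Cartesian coordinate system, as a function of `x'` and `xₙ`. -/
noncomputable def chartPoint {n : ℕ} (T : EuclideanSpace ℝ (Fin n) ≃ᵃⁱ[ℝ]
    WithLp 2 (EuclideanSpace ℝ (Fin (n - 1)) × ℝ)) (y : EuclideanSpace ℝ (Fin (n - 1))) (s : ℝ) :
    EuclideanSpace ℝ (Fin n) :=
  T.symm (WithLp.toLp 2 (y, s))

section Chart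

variable {n : ℕ} (T : EuclideanSpace ℝ (Fin n) ≃ᵃⁱ[ℝ]
    WithLp 2 (EuclideanSpace ℝ (Fin (n - 1)) × ℝ))

theorem apply_chartPoint (y : EuclideanSpace ℝ (Fin (n - 1))) (s : ℝ) :
    T (chartPoint T y s) = WithLp.toLp 2 (y, s) := T.apply_symm_apply _

@[simp] theorem fst_apply_chartPoint (y : EuclideanSpace ℝ (Fin (n - 1))) (s : ℝ) :
    (T (chartPoint T y s)).fst = y := by
  rw [apply_chartPoint]; rfl

@[simp] theorem snd_apply_chartPoint (y : EuclideanSpace ℝ (Fin (n - 1))) (s : ℝ) :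
    (T (chartPoint T y s)).snd = s := by
  rw [apply_chartPoint]; rfl

theorem chartPoint_apply (x : EuclideanSpace ℝ (Fin n)) :
    chartPoint T (T x).fst (T x).snd = x := T.symm_apply_apply x

theorem dist_fst_le (x x' : EuclideanSpace ℝ (Fin n)) :
    dist (T x).fst (T x').fst ≤ dist x x' := by
  rw [← T.dist_map x x', dist_eq_norm, dist_eq_norm]
  exact WithLp.norm_fst_le _ (T x - T x')

theorem dist_snd_le (x x' : EuclideanSpace ℝ (Fin n)) :
    dist (T x).snd (T x').snd ≤ dist x x' := by
  rw [← T.dist_map x x', dist_eq_norm, dist_eq_norm]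
  exact WithLp.norm_snd_le _ (T x - T x')

/-- Vertical translation is an isometry; this compares the boundary distances at two heights of one
line. -/
theorem dist_chartPoint_add (y y' : EuclideanSpace ℝ (Fin (n - 1))) (s s' t : ℝ) :
    dist (chartPoint T y (s + t)) (chartPoint T y' (s' + t)) =
      dist (chartPoint T y s) (chartPoint T y' s') := by
  rw [chartPoint, chartPoint, chartPoint, chartPoint, T.symm.dist_map, T.symm.dist_map,
    dist_eq_norm, dist_eq_norm, ← WithLp.toLp_sub, ← WithLp.toLp_sub]
  simp

theorem continuous_chartPoint :
    Continuous fun q : EuclideanSpace ℝ (Fin (n - 1)) × ℝ => chartPoint T q.1 q.2 :=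
  T.symm.continuous.comp (WithLp.prod_continuous_toLp 2 _ _)

/-- Fubini's theorem in Cartesian coordinates. -/
theorem lintegral_chartPoint {F : EuclideanSpace ℝ (Fin n) → ℝ≥0∞} (hF : Measurable F) :
    ∫⁻ x, F x = ∫⁻ y, ∫⁻ s, F (chartPoint T y s) := by
  have h1 : MeasurePreserving (fun q : EuclideanSpace ℝ (Fin (n - 1)) × ℝ => chartPoint T q.1 q.2)
      volume volume := by
    have hT : ∀ w, T.symm w = T.symm.linearIsometryEquiv w + T.symm 0 := fun w => by
      have := T.symm.map_vadd 0 w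
      simpa using this
    have := ((measurePreserving_add_right (volume : Measure (EuclideanSpace ℝ (Fin n)))
      (T.symm 0)).comp T.symm.linearIsometryEquiv.measurePreserving).comp
        (WithLp.volume_preserving_toLp (EuclideanSpace ℝ (Fin (n - 1))) ℝ)
    have he : (fun q : EuclideanSpace ℝ (Fin (n - 1)) × ℝ => chartPoint T q.1 q.2) =
        ((fun x => x + T.symm 0) ∘ T.symm.linearIsometryEquiv) ∘ WithLp.toLp 2 :=
      funext fun q => hT _
    rw [he]
    exact this
  rw [← h1.lintegral_comp hF, Measure.volume_eq_prod, lintegral_prod]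
  exact (hF.comp (continuous_chartPoint T).measurable).aemeasurable

end Chart

/-! ### Geometry of a Hölder boundary chart -/

/-- Near a boundary point of a Hölder domain: the vertical depth below the graph is controlled by
the distance to the boundary, which is almost monotone along vertical lines. -/
theorem IsHolderDomain.exists_chart {n : ℕ} {α : ℝ≥0} (hα : 0 < α) (hα1 : α ≤ 1)
    {Ω : Set (EuclideanSpace ℝ (Fin n))} (hΩ : IsHolderDomain α Ω) {z : EuclideanSpace ℝ (Fin n)}
    (hz : z ∈ frontier Ω) :
    ∃ (T : EuclideanSpace ℝ (Fin n) ≃ᵃⁱ[ℝ] WithLp 2 (EuclideanSpace ℝ (Fin (n - 1)) × ℝ))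
      (r a m C : ℝ) (φ : EuclideanSpace ℝ (Fin (n - 1)) → ℝ), 0 < r ∧ a < m ∧ m < 0 ∧ 0 < C ∧
      T z = 0 ∧ ContinuousOn φ (closedBall 0 r) ∧
      (∀ x ∈ Ω, ‖(T x).fst‖ ≤ r → |(T x).snd| < -m → (T x).snd < φ (T x).fst) ∧
      ∀ y ∈ closedBall 0 r, m < φ y ∧ ∀ s, a ≤ s → s < φ y → chartPoint T y s ∈ Ω ∧
        φ y - s ≤ C * bdryDist Ω (chartPoint T y s) ^ (α : ℝ) ∧
        ∀ s', a ≤ s' → s' ≤ s →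
          bdryDist Ω (chartPoint T y s) ≤ C * bdryDist Ω (chartPoint T y s') := by
  obtain ⟨hΩo, -, hΩb, hchart⟩ := hΩ
  obtain ⟨T, r, h, K, φ, hr, hh, hTz, hφ, hiff⟩ := hchart z hz
  have hne : (frontier Ω).Nonempty := ⟨z, hz⟩
  have hα0 : (0 : ℝ) < α := hα
  have hφc : ContinuousOn φ (ball 0 r) := hφ.continuousOn hα
  -- As z ∉ Ω, φ 0 ≤ 0. If φ 0 < 0, all points near z would lie above the graph, against z ∈ closure
  -- Ω.
  have hφ0 : φ 0 = 0 := by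
    have hzΩ : z ∉ Ω := fun h => (hΩo.frontier_eq ▸ hz).2 h
    have h1 : φ 0 ≤ 0 := by
      have := (hiff z (by simpa [hTz] using hr) (by simpa [hTz] using hh)).not.1 hzΩ
      simpa [hTz] using this
    refine h1.antisymm (not_lt.1 fun hneg => ?_)
    have hcfst : Tendsto (fun x => (T x).fst) (𝓝 z) (𝓝 0) := by
      have : Continuous fun x => (T x).fst := (WithLp.continuous_fst 2 _ _).comp T.continuous
      simpa [hTz] using this.tendsto z
    have hcsnd : Tendsto (fun x => (T x).snd) (𝓝 z) (𝓝 0) := by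
      have : Continuous fun x => (T x).snd := (WithLp.continuous_snd 2 _ _).comp T.continuous
      simpa [hTz] using this.tendsto z
    have hφt : Tendsto (fun x => φ (T x).fst) (𝓝 z) (𝓝 (φ 0)) :=
      (hφc.continuousAt (ball_mem_nhds 0 hr)).tendsto.comp hcfst
    have hev : ∀ᶠ x in 𝓝 z, x ∉ Ω := by
      filter_upwards [hcfst.eventually (ball_mem_nhds 0 hr), hcsnd.eventually (ball_mem_nhds 0 hh),
        hφt.eventually_lt hcsnd hneg] with x hx1 hx2 hx3 hxΩ
      have := (hiff x (by simpa using hx1) (by simpa using hx2)).1 hxΩ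
      linarith
    exact (mem_closure_iff_frequently.1 hz.1) hev
  obtain ⟨ρ, hρ, hρφ⟩ := Metric.continuousAt_iff.1 (hφc.continuousAt (ball_mem_nhds 0 hr)) (h / 8)
    (by positivity)
  set r₁ := min (ρ / 2) (r / 3) with hr₁
  have hr₁0 : 0 < r₁ := by positivity
  have hr₁r : 2 * r₁ < r := by have := min_le_right (ρ / 2) (r / 3); linarith
  have hφb : ∀ y ∈ closedBall (0 : EuclideanSpace ℝ (Fin (n - 1))) r₁, |φ y| < h / 8 := by
    intro y hy
    have hy' : dist y 0 < ρ := by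
      have := min_le_left (ρ / 2) (r / 3)
      rw [mem_closedBall] at hy
      linarith
    simpa [hφ0, Real.dist_eq] using hρφ hy'
  -- When d < c, a nearest boundary point still lies in the cylinder, where the graph description is
  -- valid. When d ≥ c, both estimates hold by boundedness alone.
  set c := min r₁ (h / 4) with hc
  have hc0 : 0 < c := by positivity
  have hcr : c ≤ r₁ := min_le_left _ _
  have hch : c ≤ h / 4 := min_le_right _ _
  obtain ⟨M, hM0, hM⟩ := exists_bdryDist_le hΩb hne
  have hcα : 0 < c ^ (α : ℝ) := by positivity
  have hin : ∀ y ∈ closedBall (0 : EuclideanSpace ℝ (Fin (n - 1))) r₁, ∀ s, -(h / 2) ≤ s →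
      s < φ y → chartPoint T y s ∈ Ω := by
    intro y hy s hs hsφ
    have := abs_lt.1 (hφb y hy)
    refine (hiff _ ?_ ?_).2 ?_
    · rw [mem_closedBall_zero_iff] at hy
      simp only [fst_apply_chartPoint]
      linarith
    · simp only [snd_apply_chartPoint, abs_lt]
      constructor <;> linarith
    · simpa using hsφ
  -- near points outside the domain lie above the graph
  have hout : ∀ y ∈ closedBall (0 : EuclideanSpace ℝ (Fin (n - 1))) r₁, ∀ s, -(h / 2) ≤ s →
      s < φ y → bdryDist Ω (chartPoint T y s) < c → ∃ y' s', ‖y'‖ < r ∧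
        φ y' ≤ s' ∧ chartPoint T y' s' ∉ Ω ∧ |s' - s| ≤ bdryDist Ω (chartPoint T y s) ∧
        dist y y' ≤ bdryDist Ω (chartPoint T y s) ∧
        bdryDist Ω (chartPoint T y s) = dist (chartPoint T y s) (chartPoint T y' s') := by
    intro y hy s hs hsφ hd
    obtain ⟨q, hq, hdq⟩ := exists_notMem_bdryDist_eq hΩo hne (chartPoint T y s)
    have h1 := dist_fst_le T (chartPoint T y s) q
    have h2 := dist_snd_le T (chartPoint T y s) q
    rw [← hdq] at h1 h2
    simp only [fst_apply_chartPoint, snd_apply_chartPoint] at h1 h2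
    have hφy := abs_lt.1 (hφb y hy)
    have hqr : ‖(T q).fst‖ < r := by
      have := norm_le_norm_add_norm_sub' (T q).fst y
      rw [mem_closedBall_zero_iff] at hy
      rw [dist_comm, dist_eq_norm] at h1
      rw [norm_sub_rev] at this
      rw [norm_sub_rev] at h1
      linarith
    rw [Real.dist_eq, abs_sub_comm] at h2
    have h2' := abs_le.1 h2
    have hqh : |(T q).snd| < h := by rw [abs_lt]; constructor <;> linarith
    refine ⟨(T q).fst, (T q).snd, hqr, ?_, ?_, h2, h1, ?_⟩
    · exact not_lt.1 ((hiff q hqr hqh).not.1 hq)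
    · rwa [chartPoint_apply]
    · rwa [chartPoint_apply]
  -- In the depth bound, c^(1-α) accounts for the vertical offset d ≤ c^(1-α) d^α, K for the Hölder
  -- variation of φ, and h / c^α for the case d ≥ c. The entries M / c and 1 serve the almost
  -- monotonicity, far from and near the boundary.
  set C := max (c ^ (1 - (α : ℝ)) + K + h / c ^ (α : ℝ)) (max (M / c) 1) with hC
  have hC0 : 0 < C := by positivity
  have hC1 : c ^ (1 - (α : ℝ)) + K + h / c ^ (α : ℝ) ≤ C := le_max_left _ _
  have hC2 : M / c ≤ C := (le_max_left _ _).trans (le_max_right _ _)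
  have hC3 : 1 ≤ C := (le_max_right _ _).trans (le_max_right _ _)
  refine ⟨T, r₁, -(h / 2), -(h / 4), C, φ, hr₁0, by linarith, by linarith, hC0, hTz,
    hφc.mono (closedBall_subset_ball (by linarith)), ?_, fun y hy => ⟨?_, fun s hs hsφ =>
      ⟨hin y hy s hs hsφ, ?_, fun s' hs' hss' => ?_⟩⟩⟩
  · intro x hx hx1 hx2
    exact (hiff x (by linarith) (by linarith)).1 hx
  · have := abs_lt.1 (hφb y hy)
    linarith
  · set d := bdryDist Ω (chartPoint T y s) with hd
    have hd0 : 0 < d := bdryDist_pos hΩo hne (hin y hy s hs hsφ)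
    have hφy := abs_lt.1 (hφb y hy)
    refine le_trans ?_ (mul_le_mul_of_nonneg_right hC1 (by positivity))
    have hK0 : (0 : ℝ) ≤ K := K.2
    rcases lt_or_ge d c with hdc | hdc
    · obtain ⟨y', s', hy'r, hφs, -, hss, hyy, -⟩ := hout y hy s hs hsφ hdc
      have hH := hφ.dist_le_of_le (by rw [mem_closedBall_zero_iff] at hy; simp; linarith)
        (by simpa using hy'r) hyy
      rw [Real.dist_eq] at hH
      have h1 := (abs_le.1 hH).2
      have h2 := (abs_le.1 hss).2
      have h3 : d ≤ c ^ (1 - (α : ℝ)) * d ^ (α : ℝ) := by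
        calc d = d ^ (1 - (α : ℝ)) * d ^ (α : ℝ) := by
              rw [← Real.rpow_add hd0, sub_add_cancel, Real.rpow_one]
          _ ≤ _ := by
              gcongr
              exact sub_nonneg.2 (by exact_mod_cast hα1)
      have h4 : 0 ≤ h / c ^ (α : ℝ) * d ^ (α : ℝ) := by positivity
      rw [add_mul, add_mul]
      linarith
    · have h1 : h ≤ h / c ^ (α : ℝ) * d ^ (α : ℝ) := by
        rw [div_mul_eq_mul_div, le_div_iff₀ hcα]
        gcongr
      have h2 : 0 ≤ (c ^ (1 - (α : ℝ)) + K) * d ^ (α : ℝ) := by positivity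
      rw [add_mul]
      linarith
  · set d := bdryDist Ω (chartPoint T y s') with hd
    have hd0 : 0 ≤ d := bdryDist_nonneg _
    rcases lt_or_ge d c with hdc | hdc
    · obtain ⟨y', t, hy'r, hφt, -, hst, -, hdist⟩ := hout y hy s' hs' (by linarith) hdc
      have hφy := abs_lt.1 (hφb y hy)
      have h2 := abs_le.1 hst
      -- Lifting the outside point nearest to the lower point by s - s' keeps it above the graph,
      -- hence outside Ω, and its distance to the upper point equals the old distance to the lower
      -- one.
      have hnot : chartPoint T y' (t + (s - s')) ∉ Ω := by
        rw [hiff _ (by simpa using hy'r) (by simp [abs_lt]; constructor <;> linarith)]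
        simp only [fst_apply_chartPoint, snd_apply_chartPoint]
        exact not_lt.2 (by linarith)
      have := bdryDist_le_dist (hin y hy s hs hsφ) hnot
      have e : chartPoint T y s = chartPoint T y (s' + (s - s')) := by congr 1; ring
      rw [e, dist_chartPoint_add, ← hdist, ← e] at this
      nlinarith
    · calc bdryDist Ω (chartPoint T y s) ≤ M := hM _ (hin y hy s hs hsφ)
        _ = M / c * c := by field_simp
        _ ≤ C * d := by gcongr

/-- If `L - t` is controlled by `δ t ^ α` and `δ` is almost decreasing, then the primitive of
`δ ^ γ` is controlled by `δ ^ (γ + α)`. -/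
theorem exists_integral_rpow_le {α C γ : ℝ} (hα : 0 < α) (hC : 0 < C) (hγ : -α < γ) :
    ∃ M > 0, ∀ (δ : ℝ → ℝ) (s b L : ℝ), s ≤ b → b < L → ContinuousOn δ (Icc s b) →
      (∀ t ∈ Icc s b, 0 < δ t) → (∀ t ∈ Icc s b, L - t ≤ C * δ t ^ α) →
      (∀ t ∈ Icc s b, δ t ≤ C * δ s) → ∫ t in s..b, δ t ^ γ ≤ M * δ s ^ γ * δ s ^ α := by
  rcases le_or_gt 0 γ with hγ0 | hγ0
  -- For γ ≥ 0 the integrand is at most (C δ s)^γ, and the interval has length below L - s ≤ C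
  -- δ(s)^α.
  · refine ⟨C ^ γ * C, by positivity, fun δ s b L hsb hbL hδ hpos hL hmono => ?_⟩
    have hs := hpos s ⟨le_rfl, hsb⟩
    have hle : ∫ t in s..b, δ t ^ γ ≤ ∫ _ in s..b, C ^ γ * δ s ^ γ := by
      refine intervalIntegral.integral_mono_on hsb ?_ intervalIntegrable_const fun t ht => ?_
      · refine ContinuousOn.intervalIntegrable ?_
        rw [uIcc_of_le hsb]
        exact hδ.rpow_const fun t ht => Or.inl (hpos t ht).ne'
      · rw [← Real.mul_rpow hC.le hs.le]
        exact Real.rpow_le_rpow (hpos t ht).le (hmono t ht) hγ0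
    have hLs := hL s ⟨le_rfl, hsb⟩
    calc ∫ t in s..b, δ t ^ γ ≤ (b - s) * (C ^ γ * δ s ^ γ) := by
          rwa [intervalIntegral.integral_const, smul_eq_mul] at hle
      _ ≤ (C * δ s ^ α) * (C ^ γ * δ s ^ γ) := by gcongr; linarith
      _ = _ := by ring
  -- For γ < 0 the depth bound gives δ^γ ≤ ((L - t)/C)^θ, integrable up to L because θ > -1.
  · set θ := γ / α with hθ
    have hθ1 : 0 < θ + 1 := by
      rw [hθ, div_add_one hα.ne']
      exact div_pos (by linarith) hα
    have hθ0 : θ ≤ 0 := div_nonpos_of_nonpos_of_nonneg hγ0.le hα.le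
    refine ⟨C / (θ + 1), by positivity, fun δ s b L hsb hbL hδ hpos hL _ => ?_⟩
    have hs := hpos s ⟨le_rfl, hsb⟩
    have hLs := hL s ⟨le_rfl, hsb⟩
    have hint : ContinuousOn (fun t => (L - t) ^ θ) (Icc s b) :=
      (continuousOn_const.sub continuousOn_id).rpow_const fun t ht =>
        Or.inl (sub_pos.2 (ht.2.trans_lt hbL)).ne'
    have hle : ∫ t in s..b, δ t ^ γ ≤ ∫ t in s..b, (C⁻¹) ^ θ * (L - t) ^ θ := by
      refine intervalIntegral.integral_mono_on hsb ?_ ?_ fun t ht => ?_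
      · refine ContinuousOn.intervalIntegrable ?_
        rw [uIcc_of_le hsb]
        exact hδ.rpow_const fun t ht => Or.inl (hpos t ht).ne'
      · refine ContinuousOn.intervalIntegrable ?_
        rw [uIcc_of_le hsb]
        exact continuousOn_const.mul hint
      · have hLt : 0 < L - t := sub_pos.2 (ht.2.trans_lt hbL)
        have h1 : δ t ^ γ = (δ t ^ α) ^ θ := by
          rw [← Real.rpow_mul (hpos t ht).le, hθ, mul_div_cancel₀ _ hα.ne']
        rw [h1, ← Real.mul_rpow (by positivity) hLt.le]
        refine Real.rpow_le_rpow_of_nonpos (by positivity) ?_ hθ0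
        rw [inv_mul_le_iff₀ hC]
        exact hL t ht
    have hprim : ∫ t in s..b, (L - t) ^ θ ≤ (L - s) ^ (θ + 1) / (θ + 1) := by
      rw [intervalIntegral.integral_comp_sub_left (fun t => t ^ θ),
        integral_rpow (Or.inl (by linarith))]
      gcongr
      have : 0 ≤ (L - b) ^ (θ + 1) := Real.rpow_nonneg (by linarith) _
      linarith
    rw [intervalIntegral.integral_const_mul] at hle
    calc ∫ t in s..b, δ t ^ γ ≤ (C⁻¹) ^ θ * ((L - s) ^ (θ + 1) / (θ + 1)) := by
          refine hle.trans ?_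
          gcongr
      _ ≤ (C⁻¹) ^ θ * ((C * δ s ^ α) ^ (θ + 1) / (θ + 1)) := by
          gcongr
          linarith
      _ = _ := by
          have h1 : (δ s ^ α) ^ (θ + 1) = δ s ^ γ * δ s ^ α := by
            rw [← Real.rpow_mul hs.le, mul_add, mul_one, hθ, mul_div_cancel₀ _ hα.ne',
              Real.rpow_add hs]
          rw [Real.mul_rpow hC.le (by positivity), h1, Real.inv_rpow hC.le, Real.rpow_add_one hC.ne']
          have : C ^ θ ≠ 0 := by positivity
          field_simp

/-! ### Compact slabs below the graph and derivatives along vertical lines -/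

/-- In Cartesian coordinates, the points `(x', xₙ)` with `|x'| ≤ r` and `a ≤ xₙ ≤ φ(x') - ε`. -/
def chartSlab {n : ℕ} (T : EuclideanSpace ℝ (Fin n) ≃ᵃⁱ[ℝ]
    WithLp 2 (EuclideanSpace ℝ (Fin (n - 1)) × ℝ)) (φ : EuclideanSpace ℝ (Fin (n - 1)) → ℝ)
    (r a ε : ℝ) : Set (EuclideanSpace ℝ (Fin n)) :=
  {x | ‖(T x).fst‖ ≤ r ∧ a ≤ (T x).snd ∧ (T x).snd ≤ φ (T x).fst - ε}

section Slab

variable {n : ℕ} (T : EuclideanSpace ℝ (Fin n) ≃ᵃⁱ[ℝ]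
    WithLp 2 (EuclideanSpace ℝ (Fin (n - 1)) × ℝ)) {φ : EuclideanSpace ℝ (Fin (n - 1)) → ℝ}
    {r : ℝ}

/-- In coordinates the slab is a closed, bounded part of a hypograph over a closed ball. For ε > 0
it serves as a compact set on which to mollify. -/
theorem isCompact_chartSlab (hφ : ContinuousOn φ (closedBall 0 r)) (a ε : ℝ) :
    IsCompact (chartSlab T φ r a ε) := by
  have hcb : IsCompact (closedBall (0 : EuclideanSpace ℝ (Fin (n - 1))) r) :=
    isCompact_closedBall 0 r
  obtain ⟨B, hB⟩ := (hcb.image_of_continuousOn hφ).bddAbove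
  have hcl : IsClosed {q : EuclideanSpace ℝ (Fin (n - 1)) × ℝ |
      q.1 ∈ closedBall 0 r ∧ q.2 ≤ φ q.1 - ε} :=
    isClosed_closedBall.hypograph (hφ.sub continuousOn_const)
  have hK : IsCompact ((closedBall (0 : EuclideanSpace ℝ (Fin (n - 1))) r ×ˢ Icc a (B - ε)) ∩
      {q | q.1 ∈ closedBall 0 r ∧ q.2 ≤ φ q.1 - ε}) :=
    (hcb.prod isCompact_Icc).inter_right hcl
  convert hK.image (continuous_chartPoint T) using 1
  ext x
  constructor
  · rintro ⟨h1, h2, h3⟩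
    have h1' : (T x).fst ∈ closedBall (0 : EuclideanSpace ℝ (Fin (n - 1))) r := by simpa using h1
    refine ⟨((T x).fst, (T x).snd), ⟨⟨h1', h2, ?_⟩, h1', h3⟩, chartPoint_apply T x⟩
    have := hB (mem_image_of_mem φ h1')
    exact h3.trans (by linarith)
  · rintro ⟨⟨y, s⟩, ⟨⟨h1, h2, -⟩, -, h3⟩, rfl⟩
    refine ⟨by simpa using h1, by simpa using h2, by simpa using h3⟩

theorem setLIntegral_chartSlab (hφ : ContinuousOn φ (closedBall 0 r)) (a ε : ℝ)
    {F : EuclideanSpace ℝ (Fin n) → ℝ≥0∞} (hF : Measurable F) :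
    ∫⁻ x in chartSlab T φ r a ε, F x =
      ∫⁻ y in closedBall 0 r, ∫⁻ s in Icc a (φ y - ε), F (chartPoint T y s) := by
  have hm := (isCompact_chartSlab T hφ a ε).measurableSet
  rw [← lintegral_indicator hm, lintegral_chartPoint T (hF.indicator hm),
    ← lintegral_indicator measurableSet_closedBall]
  refine lintegral_congr fun y => ?_
  by_cases hy : y ∈ closedBall (0 : EuclideanSpace ℝ (Fin (n - 1))) r
  · rw [indicator_of_mem hy, ← lintegral_indicator measurableSet_Icc]
    refine lintegral_congr fun s => ?_
    have : chartPoint T y s ∈ chartSlab T φ r a ε ↔ s ∈ Icc a (φ y - ε) := by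
      rw [mem_closedBall_zero_iff] at hy
      simp [chartSlab, hy]
    by_cases hs : s ∈ Icc a (φ y - ε)
    · rw [indicator_of_mem hs, indicator_of_mem (this.2 hs)]
    · rw [indicator_of_notMem hs, indicator_of_notMem (mt this.1 hs)]
  · rw [indicator_of_notMem hy]
    refine (lintegral_congr fun s => ?_).trans lintegral_zero
    refine indicator_of_notMem (fun h => hy ?_) _
    simpa using h.1

theorem hasDerivAt_chartPoint (y : EuclideanSpace ℝ (Fin (n - 1))) (s : ℝ) :
    HasDerivAt (chartPoint T y) (T.symm.linearIsometryEquiv (WithLp.toLp 2 (0, 1))) s := by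
  have h : chartPoint T y = fun s => s • T.symm.linearIsometryEquiv (WithLp.toLp 2 (0, 1)) +
      chartPoint T y 0 := by
    funext s
    have := T.symm.map_vadd (WithLp.toLp 2 (y, 0)) (s • WithLp.toLp 2 (0, 1))
    rw [map_smul] at this
    simp only [vadd_eq_add, ← WithLp.toLp_smul, ← WithLp.toLp_add] at this
    simpa [chartPoint] using this
  rw [h]
  simpa using ((hasDerivAt_id s).smul_const
    (T.symm.linearIsometryEquiv (WithLp.toLp 2 (0, 1)))).add_const (chartPoint T y 0)

/-- The vertical direction is a unit vector, since the coordinates are isometric. -/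
theorem norm_deriv_comp_chartPoint_le {u : EuclideanSpace ℝ (Fin n) → ℝ} (hu : ContDiff ℝ 1 u)
    (y : EuclideanSpace ℝ (Fin (n - 1))) (s : ℝ) :
    ‖deriv (fun s => u (chartPoint T y s)) s‖ ≤ ‖fderiv ℝ u (chartPoint T y s)‖ := by
  have h1 := ((hu.differentiable one_ne_zero) (chartPoint T y s)).hasFDerivAt.comp_hasDerivAt s
    (hasDerivAt_chartPoint T y s)
  have h2 : deriv (fun s => u (chartPoint T y s)) s = _ := h1.deriv
  rw [h2]
  refine (ContinuousLinearMap.le_opNorm _ _).trans_eq ?_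
  rw [LinearIsometryEquiv.norm_map, WithLp.prod_norm_eq_of_L2]
  simp

theorem contDiff_comp_chartPoint {u : EuclideanSpace ℝ (Fin n) → ℝ} (hu : ContDiff ℝ 1 u)
    (y : EuclideanSpace ℝ (Fin (n - 1))) : ContDiff ℝ 1 fun s => u (chartPoint T y s) := by
  refine hu.comp (contDiff_one_iff_deriv.2
    ⟨fun s => (hasDerivAt_chartPoint T y s).differentiableAt, ?_⟩)
  rw [show deriv (chartPoint T y) = _ from funext fun s => (hasDerivAt_chartPoint T y s).deriv]
  exact continuous_const

end Slab

/-! ### Hardy inequality near a boundary point -/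

section ChartHardy

variable {n : ℕ} {Ω : Set (EuclideanSpace ℝ (Fin n))}

theorem measurable_ofReal_bdryDist_rpow (γ : ℝ) :
    Measurable fun x => ENNReal.ofReal (bdryDist Ω x ^ γ) :=
  (continuous_bdryDist.measurable.pow_const γ).ennreal_ofReal

/-- Weighted **Hardy inequality** below the graph of a function, for `C¹` functions. -/
theorem exists_lintegral_chartSlab_le {p α γ : ℝ} (hp : 1 < p) (hα : 0 < α) (hγ : -α < γ)
    (T : EuclideanSpace ℝ (Fin n) ≃ᵃⁱ[ℝ] WithLp 2 (EuclideanSpace ℝ (Fin (n - 1)) × ℝ))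
    {r a m C : ℝ} {φ : EuclideanSpace ℝ (Fin (n - 1)) → ℝ} (ham : a < m) (hC : 0 < C)
    (hφ : ContinuousOn φ (closedBall 0 r))
    (hpos : ∀ y ∈ closedBall 0 r, ∀ s, a ≤ s → s < φ y → 0 < bdryDist Ω (chartPoint T y s))
    (hdepth : ∀ y ∈ closedBall 0 r, ∀ s, a ≤ s → s < φ y →
      φ y - s ≤ C * bdryDist Ω (chartPoint T y s) ^ α)
    (hmono : ∀ y ∈ closedBall 0 r, ∀ s, a ≤ s → s < φ y → ∀ s', a ≤ s' → s' ≤ s →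
      bdryDist Ω (chartPoint T y s) ≤ C * bdryDist Ω (chartPoint T y s')) :
    ∃ C₁ C₂ : ℝ≥0, ∀ ε > 0, (∀ y ∈ closedBall 0 r, m ≤ φ y - ε) →
      ∀ u : EuclideanSpace ℝ (Fin n) → ℝ, ContDiff ℝ 1 u →
      ∫⁻ x in chartSlab T φ r m ε, ENNReal.ofReal (bdryDist Ω x ^ γ) * ‖u x‖ₑ ^ p ≤
        C₁ * (∫⁻ x in chartSlab T (fun _ => m) r a 0,
          ENNReal.ofReal (bdryDist Ω x ^ (γ + α)) * ‖u x‖ₑ ^ p) +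
        C₂ * ∫⁻ x in chartSlab T φ r a ε,
          ENNReal.ofReal (bdryDist Ω x ^ (γ + α * p)) * ‖fderiv ℝ u x‖ₑ ^ p := by
  obtain ⟨M, hM, hMw⟩ := exists_integral_rpow_le hα hC hγ
  refine ⟨(2 * M / (m - a)).toNNReal, ((2 * p * M) ^ p).toNNReal, fun ε hε hmε u hu => ?_⟩
  have hum : Measurable fun x => ‖u x‖ₑ ^ p := hu.continuous.measurable.enorm.pow_const p
  have hDm : Measurable fun x => ‖fderiv ℝ u x‖ₑ ^ p :=
    (hu.continuous_fderiv one_ne_zero).measurable.enorm.pow_const p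
  have hF : ∀ γ : ℝ, Measurable fun x => ENNReal.ofReal (bdryDist Ω x ^ γ) * ‖u x‖ₑ ^ p :=
    fun γ => (measurable_ofReal_bdryDist_rpow (Ω := Ω) γ).mul hum
  have hF' : Measurable fun x => ENNReal.ofReal (bdryDist Ω x ^ (γ + α * p)) *
    ‖fderiv ℝ u x‖ₑ ^ p := (measurable_ofReal_bdryDist_rpow _).mul hDm
  have hline : ∀ y ∈ closedBall (0 : EuclideanSpace ℝ (Fin (n - 1))) r,
      ∫⁻ s in Icc m (φ y - ε), ENNReal.ofReal (bdryDist Ω (chartPoint T y s) ^ γ) *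
        ‖u (chartPoint T y s)‖ₑ ^ p ≤
      ENNReal.ofReal (2 * M / (m - a)) * (∫⁻ s in Icc a (m - 0),
        ENNReal.ofReal (bdryDist Ω (chartPoint T y s) ^ (γ + α)) * ‖u (chartPoint T y s)‖ₑ ^ p) +
      ENNReal.ofReal ((2 * p * M) ^ p) * ∫⁻ s in Icc a (φ y - ε),
        ENNReal.ofReal (bdryDist Ω (chartPoint T y s) ^ (γ + α * p)) *
          ‖fderiv ℝ u (chartPoint T y s)‖ₑ ^ p := by
    intro y hy
    have hd : Continuous fun s => bdryDist Ω (chartPoint T y s) :=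
      continuous_bdryDist.comp
      ((continuous_chartPoint T).comp (continuous_const.prodMk continuous_id : Continuous fun s => (y, s)))
    have hlt : ∀ s ∈ Icc a (φ y - ε), s < φ y := fun s hs => by have := hs.2; linarith
    have hp0 : ∀ s ∈ Icc a (φ y - ε), 0 < bdryDist Ω (chartPoint T y s) := fun s hs =>
      hpos y hy s hs.1 (hlt s hs)
    have hw : ContinuousOn (fun s => bdryDist Ω (chartPoint T y s) ^ γ) (Icc a (φ y - ε)) :=
      hd.continuousOn.rpow_const fun s hs => Or.inl (hp0 s hs).ne'
    have hD : ContinuousOn (fun s => bdryDist Ω (chartPoint T y s) ^ α) (Icc a (φ y - ε)) :=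
      hd.continuousOn.rpow_const fun s hs => Or.inl (hp0 s hs).ne'
    -- On each line w = d^γ and D = d^α. The interval stops at b = φ y - ε, below the graph height L
    -- = φ y, with a constant M independent of y and ε.
    have hH := lintegral_weight_mul_rpow_le ham (hmε y hy) hM hp hw hD
      (fun s _ => Real.rpow_nonneg (bdryDist_nonneg _) _)
      (fun s _ => Real.rpow_nonneg (bdryDist_nonneg _) _)
      (fun s hs => hMw _ s (φ y - ε) (φ y) hs.2 (by linarith) hd.continuousOn
        (fun t ht => hp0 t ⟨hs.1.trans ht.1, ht.2⟩)
        (fun t ht => hdepth y hy t (hs.1.trans ht.1) (hlt t ⟨hs.1.trans ht.1, ht.2⟩))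
        (fun t ht => hmono y hy t (hs.1.trans ht.1) (hlt t ⟨hs.1.trans ht.1, ht.2⟩) s hs.1 ht.1))
      (contDiff_comp_chartPoint T hu y)
    refine hH.trans (add_le_add (mul_le_mul_right ?_ _) (mul_le_mul_right ?_ _))
    · rw [sub_zero]
      refine (setLIntegral_congr_fun measurableSet_Icc fun s hs => ?_).le
      have hs' : s ∈ Icc a (φ y - ε) := ⟨hs.1, hs.2.trans (hmε y hy)⟩
      simp only [Real.rpow_add (hp0 s hs')]
    · refine setLIntegral_mono' measurableSet_Icc fun s hs => ?_
      rw [Real.rpow_add (hp0 s hs), Real.rpow_mul (hp0 s hs).le]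
      gcongr
      exact enorm_le_iff_norm_le.2 (norm_deriv_comp_chartPoint_le T hu y s)
  have hA : Measurable fun y => ∫⁻ s in Icc a (m - 0),
      ENNReal.ofReal (bdryDist Ω (chartPoint T y s) ^ (γ + α)) *
        ‖u (chartPoint T y s)‖ₑ ^ p := by
    have : Measurable fun q : EuclideanSpace ℝ (Fin (n - 1)) × ℝ =>
        ENNReal.ofReal (bdryDist Ω (chartPoint T q.1 q.2) ^ (γ + α)) *
        ‖u (chartPoint T q.1 q.2)‖ₑ ^ p := (hF (γ + α)).comp (continuous_chartPoint T).measurable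
    exact this.lintegral_prod_right'
  rw [setLIntegral_chartSlab T hφ m ε (hF γ),
    setLIntegral_chartSlab T continuousOn_const a 0 (hF (γ + α)),
    setLIntegral_chartSlab T hφ a ε hF']
  refine (setLIntegral_mono' measurableSet_closedBall hline).trans_eq ?_
  rw [lintegral_add_left (hA.const_mul _), lintegral_const_mul' _ _ ENNReal.ofReal_ne_top,
    lintegral_const_mul' _ _ ENNReal.ofReal_ne_top]
  rfl

/-- **Hardy inequality** near a boundary point of a Hölder domain. -/
theorem IsHolderDomain.exists_local_hardy {α : ℝ≥0} (hα : 0 < α) (hα1 : α ≤ 1)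
    (hΩ : IsHolderDomain α Ω) {p γ : ℝ} (hp : 1 < p) (hγ : -(α : ℝ) < γ)
    {z : EuclideanSpace ℝ (Fin n)} (hz : z ∈ frontier Ω) :
    ∃ U ∈ 𝓝 z, ∃ K ⊆ Ω, IsCompact K ∧ ∃ C : ℝ≥0,
      ∀ (f : EuclideanSpace ℝ (Fin n) → ℝ) (G : EuclideanSpace ℝ (Fin n) → EuclideanSpace ℝ (Fin n)),
        Measurable f → Measurable G → IsWeakGradient Ω f G →
        ∫⁻ x in U ∩ Ω, ENNReal.ofReal (bdryDist Ω x ^ γ) * ‖f x‖ₑ ^ p ≤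
          C * ((∫⁻ x in K, ENNReal.ofReal (bdryDist Ω x ^ γ) * ‖f x‖ₑ ^ p) +
            ∫⁻ x in Ω, ENNReal.ofReal (bdryDist Ω x ^ (γ + α * p)) * ‖G x‖ₑ ^ p) := by
  obtain ⟨T, r, a, m, C, φ, hr, ham, hm0, hC, hTz, hφ, hUφ, hch⟩ := hΩ.exists_chart hα hα1 hz
  have hne : (frontier Ω).Nonempty := ⟨z, hz⟩
  have hα0 : (0 : ℝ) < α := hα
  have hγα : 0 < γ + α := by linarith
  have hγp : 0 < γ + α * p := by nlinarith
  obtain ⟨C₁, C₂, hH⟩ := exists_lintegral_chartSlab_le (Ω := Ω) hp hα0 hγ T ham hC hφ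
    (fun y hy s hs hsφ => bdryDist_pos hΩ.1 hne ((hch y hy).2 s hs hsφ).1)
    (fun y hy s hs hsφ => ((hch y hy).2 s hs hsφ).2.1)
    (fun y hy s hs hsφ => ((hch y hy).2 s hs hsφ).2.2)
  obtain ⟨ε₀, hε₀, hε₀φ⟩ : ∃ ε₀ > 0, ∀ y ∈ closedBall 0 r, m ≤ φ y - ε₀ := by
    obtain ⟨y₀, hy₀, hmin⟩ := (isCompact_closedBall (0 : EuclideanSpace ℝ (Fin (n - 1))) r).exists_isMinOn
      ⟨0, mem_closedBall_self hr.le⟩ hφ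
    refine ⟨φ y₀ - m, sub_pos.2 (hch y₀ hy₀).1, fun y hy => ?_⟩
    have : φ y₀ ≤ φ y := hmin hy
    linarith
  have hslabΩ : ∀ ε > 0, chartSlab T φ r a ε ⊆ Ω := fun ε hε x hx => by
    have := ((hch (T x).fst (by simpa using hx.1)).2 (T x).snd hx.2.1 (by have := hx.2.2; linarith)).1
    rwa [chartPoint_apply] at this
  set B := chartSlab T (fun _ => m) r a 0 with hB
  have hBc : IsCompact B := isCompact_chartSlab T continuousOn_const a 0
  have hBslab : ∀ ε, (∀ y ∈ closedBall 0 r, m ≤ φ y - ε) → B ⊆ chartSlab T φ r a ε :=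
    fun ε h x hx => ⟨hx.1, hx.2.1, by
      have h1 := hx.2.2
      have h2 := h (T x).fst (by simpa using hx.1)
      linarith⟩
  have hBΩ : B ⊆ Ω := (hBslab ε₀ hε₀φ).trans (hslabΩ ε₀ hε₀)
  -- a compact neighbourhood of `B`, and comparison of the weights there
  obtain ⟨δ₀, hδ₀, hδ₀Ω⟩ := hBc.exists_cthickening_subset_open hΩ.1 hBΩ
  set K := cthickening δ₀ B with hK
  have hKc : IsCompact K := hBc.cthickening
  obtain ⟨c, hc⟩ : ∃ c : ℝ≥0, ∀ x ∈ B, ∀ y ∈ K, ENNReal.ofReal (bdryDist Ω x ^ (γ + α)) ≤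
      c * ENNReal.ofReal (bdryDist Ω y ^ γ) := by
    have hcont : ContinuousOn (fun y => bdryDist Ω y ^ (-γ)) K :=
      continuous_bdryDist.continuousOn.rpow_const fun y hy =>
        Or.inl (bdryDist_pos hΩ.1 hne (hδ₀Ω hy)).ne'
    obtain ⟨b, hb⟩ := (hKc.image_of_continuousOn hcont).bddAbove
    obtain ⟨M, hM0, hM⟩ := exists_bdryDist_le hΩ.2.2.1 hne
    refine ⟨(M ^ (γ + α) * b).toNNReal, fun x hx y hy => ?_⟩
    have hdy := bdryDist_pos hΩ.1 hne (hδ₀Ω hy)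
    change _ ≤ ENNReal.ofReal _ * _
    have hb' : bdryDist Ω y ^ (-γ) ≤ b := hb (mem_image_of_mem _ hy)
    have hyγ : 0 < bdryDist Ω y ^ (-γ) := by positivity
    rw [← ENNReal.ofReal_mul (mul_nonneg (by positivity) (hyγ.le.trans hb'))]
    refine ENNReal.ofReal_le_ofReal ?_
    calc bdryDist Ω x ^ (γ + α) ≤ M ^ (γ + α) :=
          Real.rpow_le_rpow (bdryDist_nonneg _) (hM x (hBΩ hx)) hγα.le
      _ = M ^ (γ + α) * (bdryDist Ω y ^ (-γ) * bdryDist Ω y ^ γ) := by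
          rw [← Real.rpow_add hdy, neg_add_cancel, Real.rpow_zero, mul_one]
      _ ≤ M ^ (γ + α) * (b * bdryDist Ω y ^ γ) := by gcongr
      _ = _ := by ring
  set U : Set (EuclideanSpace ℝ (Fin n)) := {x | ‖(T x).fst‖ < r ∧ |(T x).snd| < -m} with hU
  have hUz : U ∈ 𝓝 z := by
    have h1 : Continuous fun x => ‖(T x).fst‖ :=
      ((WithLp.continuous_fst 2 _ _).comp T.continuous).norm
    have h2 : Continuous fun x => |(T x).snd| :=
      ((WithLp.continuous_snd 2 _ _).comp T.continuous).abs
    refine ((isOpen_lt h1 continuous_const).inter (isOpen_lt h2 continuous_const)).mem_nhds ?_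
    constructor <;> simp [hTz, hr, hm0]
  refine ⟨U, hUz, K, hδ₀Ω, hKc, C₁ * c + C₂ * (2 ^ (γ + α * p) : ℝ).toNNReal,
    fun f G hf hG hfG => ?_⟩
  set IK := ∫⁻ x in K, ENNReal.ofReal (bdryDist Ω x ^ γ) * ‖f x‖ₑ ^ p with hIK
  set IG := ∫⁻ x in Ω, ENNReal.ofReal (bdryDist Ω x ^ (γ + α * p)) * ‖G x‖ₑ ^ p with hIG
  -- The mollification scale depends on ε, but the constants do not, so ε can tend to 0 afterwards.
  have hslab : ∀ ε > 0, ε ≤ ε₀ →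
      ∫⁻ x in chartSlab T φ r m ε, ENNReal.ofReal (bdryDist Ω x ^ γ) * ‖f x‖ₑ ^ p ≤
        C₁ * (c * IK) + C₂ * (ENNReal.ofReal (2 ^ (γ + α * p)) * IG) := by
    intro ε hε hεε₀
    have hεφ : ∀ y ∈ closedBall 0 r, m ≤ φ y - ε := fun y hy => by
      have := hε₀φ y hy
      linarith
    set R := chartSlab T φ r a ε with hR
    have hRc : IsCompact R := isCompact_chartSlab T hφ a ε
    obtain ⟨κ, hκ, hκd⟩ : ∃ κ > 0, ∀ x ∈ R, κ ≤ bdryDist Ω x := by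
      refine hRc.exists_forall_le' continuous_bdryDist.continuousOn fun x hx => ?_
      exact bdryDist_pos hΩ.1 hne (hslabΩ ε hε hx)
    -- The bound κ / 2 gives d(x) ≤ 2 d(y) for x ∈ R and |x - y| ≤ δ, whence the factor 2^(γ+αp);
    -- the bound δ₀ keeps the interior term inside K.
    set δ := min (κ / 2) δ₀ with hδ
    have hδ0 : 0 < δ := by positivity
    have hδκ : δ ≤ κ / 2 := min_le_left _ _
    have hRΩ : cthickening δ R ⊆ Ω := by
      intro y hy
      rw [hRc.cthickening_eq_biUnion_closedBall hδ0.le] at hy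
      obtain ⟨x, hx, hxy⟩ := mem_iUnion₂.1 hy
      by_contra hyΩ
      have h1 := bdryDist_le_dist (hslabΩ ε hε hx) hyΩ
      have h2 := hκd x hx
      rw [mem_closedBall, dist_comm] at hxy
      linarith
    obtain ⟨u, hu, hlim, hbd⟩ := hfG.exists_approx hf hG hRc hδ0 hRΩ
    have hsub : chartSlab T φ r m ε ⊆ R := fun x hx => ⟨hx.1, ham.le.trans hx.2.1, hx.2.2⟩
    refine lintegral_le_of_ae_tendsto
      (F := fun k x => ENNReal.ofReal (bdryDist Ω x ^ γ) * ‖u k x‖ₑ ^ p)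
      (fun k => (measurable_ofReal_bdryDist_rpow γ).mul
        ((hu k).continuous.measurable.enorm.pow_const p)) ?_ fun k => ?_
    · rw [ae_restrict_iff' (isCompact_chartSlab T hφ m ε).measurableSet]
      filter_upwards [hlim] with x hx hxs
      refine ENNReal.Tendsto.const_mul ?_ (Or.inr ENNReal.ofReal_ne_top)
      exact ((ENNReal.continuous_rpow_const.comp continuous_enorm).tendsto _).comp (hx (hsub hxs))
    · refine (hH ε hε hεφ (u k) (hu k)).trans ?_
      gcongr
      · have := (hbd p hp.le (B.indicator fun x => ENNReal.ofReal (bdryDist Ω x ^ (γ + α)))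
          (K.indicator fun x => c * ENNReal.ofReal (bdryDist Ω x ^ γ))
          ((measurable_ofReal_bdryDist_rpow _).indicator hBc.measurableSet)
          (fun x _ y hxy => ?_) k).1
        · calc ∫⁻ x in B, ENNReal.ofReal (bdryDist Ω x ^ (γ + α)) * ‖u k x‖ₑ ^ p
              = ∫⁻ x in B, B.indicator (fun x => ENNReal.ofReal (bdryDist Ω x ^ (γ + α))) x *
                  ‖u k x‖ₑ ^ p := setLIntegral_congr_fun hBc.measurableSet fun x hx => by
                simp only [indicator_of_mem hx]
            _ ≤ _ := lintegral_mono_set (hBslab ε hεφ)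
            _ ≤ _ := this
            _ ≤ ∫⁻ x in Ω, K.indicator (fun x => c *
                  (ENNReal.ofReal (bdryDist Ω x ^ γ) * ‖f x‖ₑ ^ p)) x := by
                refine lintegral_mono fun x => ?_
                by_cases hx : x ∈ K
                · simp only [indicator_of_mem hx, mul_assoc, le_refl]
                · simp [indicator_of_notMem hx]
            _ ≤ ∫⁻ x in K, c * (ENNReal.ofReal (bdryDist Ω x ^ γ) * ‖f x‖ₑ ^ p) :=
                (setLIntegral_le_lintegral _ _).trans (lintegral_indicator_le _ _)
            _ = c * IK := lintegral_const_mul' _ _ ENNReal.coe_ne_top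
        · by_cases hx : x ∈ B
          · have hy : y ∈ K := closedBall_subset_cthickening hx δ₀
              (by rw [mem_closedBall, dist_comm]; exact hxy.trans (min_le_right _ _))
            rw [indicator_of_mem hx, indicator_of_mem hy]
            exact hc x hx y hy
          · rw [indicator_of_notMem hx]
            exact zero_le
      · have := (hbd p hp.le (fun x => ENNReal.ofReal (bdryDist Ω x ^ (γ + α * p)))
          (fun x => ENNReal.ofReal (2 ^ (γ + α * p)) *
            ENNReal.ofReal (bdryDist Ω x ^ (γ + α * p)))
          (measurable_ofReal_bdryDist_rpow _) (fun x hx y hxy => ?_) k).2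
        · simp_rw [mul_assoc] at this
          rwa [lintegral_const_mul' _ _ ENNReal.ofReal_ne_top] at this
        · rw [← ENNReal.ofReal_mul (by positivity), ← Real.mul_rpow zero_le_two (bdryDist_nonneg _)]
          refine ENNReal.ofReal_le_ofReal (Real.rpow_le_rpow (bdryDist_nonneg _) ?_ hγp.le)
          have h1 : bdryDist Ω x ≤ bdryDist Ω y + dist x y := infDist_le_infDist_add_dist
          have h2 := hκd x hx
          linarith
  -- Increasing slabs exhaust the part of Ω near z, so monotone convergence transfers the uniform
  -- bound.
  have hcov : U ∩ Ω ⊆ ⋃ j : ℕ, chartSlab T φ r m (ε₀ / (j + 1)) := by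
    rintro x ⟨⟨hx1, hx2⟩, hxΩ⟩
    have hlt := sub_pos.2 (hUφ x hxΩ hx1.le hx2)
    obtain ⟨j, hj⟩ := exists_nat_gt (ε₀ / (φ (T x).fst - (T x).snd))
    refine mem_iUnion.2 ⟨j, hx1.le, ?_, ?_⟩
    · have := (abs_lt.1 hx2).1
      linarith
    · have : ε₀ / (j + 1) ≤ φ (T x).fst - (T x).snd := by
        rw [div_lt_iff₀ hlt] at hj
        rw [div_le_iff₀ (by positivity)]
        nlinarith
      linarith
  have hdir : Directed (· ⊆ ·) fun j : ℕ => chartSlab T φ r m (ε₀ / (j + 1)) := by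
    refine directed_of_isDirected_le fun i j hij x hx => ⟨hx.1, hx.2.1, hx.2.2.trans ?_⟩
    have : ε₀ / (j + 1) ≤ ε₀ / (i + 1) := by gcongr
    linarith
  calc ∫⁻ x in U ∩ Ω, ENNReal.ofReal (bdryDist Ω x ^ γ) * ‖f x‖ₑ ^ p
      ≤ ∫⁻ x in ⋃ j : ℕ, chartSlab T φ r m (ε₀ / (j + 1)),
          ENNReal.ofReal (bdryDist Ω x ^ γ) * ‖f x‖ₑ ^ p := lintegral_mono_set hcov
    _ ≤ C₁ * (c * IK) + C₂ * (ENNReal.ofReal (2 ^ (γ + α * p)) * IG) := by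
        rw [setLIntegral_iUnion_of_directed _ hdir]
        refine iSup_le fun j => hslab _ (by positivity) (div_le_self hε₀.le ?_)
        have : (0 : ℝ) ≤ j := j.cast_nonneg
        linarith
    _ ≤ _ := by
        push_cast
        rw [← ENNReal.ofReal, ← mul_assoc, ← mul_assoc, mul_add]
        gcongr
        · exact le_self_add
        · exact le_add_self

end ChartHardy

/-! ### Global Hardy inequality and the improved Poincaré inequality -/

section Global

variable {n : ℕ} {Ω : Set (EuclideanSpace ℝ (Fin n))}

local notation "𝔼" => EuclideanSpace ℝ (Fin n)

/-- A partial derivative of a test function has integral zero, by parts against the constant 1.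
Splitting the integral requires f ∂ᵢψ to be integrable, which holds on the compact support of ψ. -/
theorem IsWeakGradient.sub_const {f : 𝔼 → ℝ} {G : 𝔼 → 𝔼} (h : IsWeakGradient Ω f G) (c : ℝ) :
    IsWeakGradient Ω (fun x => f x - c) G := by
  refine ⟨h.1.sub ((locallyIntegrable_const c).locallyIntegrableOn Ω), h.2.1, fun ψ hψ hψc hψs i => ?_⟩
  have hψ1 : ContDiff ℝ 1 ψ := hψ.of_le (by exact_mod_cast le_top)
  set e : 𝔼 := EuclideanSpace.single i 1
  have hcont : Continuous fun x => fderiv ℝ ψ x e :=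
    (hψ1.continuous_fderiv one_ne_zero).clm_apply continuous_const
  have hcs : HasCompactSupport fun x => fderiv ℝ ψ x e :=
    (hψc.fderiv (𝕜 := ℝ)).comp_left (g := fun L : 𝔼 →L[ℝ] ℝ => L e) rfl
  have hout : ∀ x, x ∉ tsupport ψ → fderiv ℝ ψ x e = 0 := fun x hx => by
    rw [image_eq_zero_of_notMem_tsupport fun h => hx (tsupport_fderiv_subset ℝ h)]
    rfl
  have hi : Integrable fun x => fderiv ℝ ψ x e := hcont.integrable_of_hasCompactSupport hcs
  have hzero : ∫ x in Ω, fderiv ℝ ψ x e = 0 := by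
    rw [setIntegral_eq_integral_of_forall_compl_eq_zero fun x hx => hout x fun h => hx (hψs h)]
    have := integral_mul_fderiv_eq_neg_fderiv_mul_of_integrable (μ := volume)
      (f := fun _ : 𝔼 => (1 : ℝ)) (g := ψ) (v := e) (by simp) (by simpa using hi)
      (by simpa using hψ1.continuous.integrable_of_hasCompactSupport hψc)
      (fun x _ => differentiableAt_const _) (fun x _ => (hψ1.differentiable one_ne_zero) x)
    simpa using this
  have hfi : IntegrableOn (fun x => f x * fderiv ℝ ψ x e) Ω := by
    have hfK := h.1.integrableOn_compact_subset hψs hψc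
    obtain ⟨M, hM⟩ := hcs.exists_bound_of_continuous hcont
    have h1 : IntegrableOn (fun x => f x * fderiv ℝ ψ x e) (tsupport ψ) :=
      hfK.mul_bdd hcont.aestronglyMeasurable (Eventually.of_forall hM)
    exact (integrableOn_iff_integrable_of_support_subset fun x hx => by
      by_contra hxt
      exact hx (by simp [hout x hxt])).1 h1 |>.integrableOn
  simp_rw [sub_mul]
  rw [integral_sub hfi (hi.integrableOn.const_mul c), integral_const_mul, hzero, mul_zero, sub_zero]
  exact h.2.2 ψ hψ hψc hψs i

theorem isWeakGradient_const (c : ℝ) : IsWeakGradient Ω (fun _ => c) fun _ => 0 := by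
  have h0 : IsWeakGradient Ω (fun _ => (0 : ℝ)) fun _ => 0 :=
    ⟨locallyIntegrableOn_zero, locallyIntegrableOn_zero, by simp⟩
  simpa using h0.sub_const (-c)

/-- Global **Hardy inequality** on a Hölder domain, with an interior term. -/
theorem IsHolderDomain.exists_hardy {α : ℝ≥0} (hα : 0 < α) (hα1 : α ≤ 1)
    (hΩ : IsHolderDomain α Ω) {p γ : ℝ} (hp : 1 < p) (hγ : -(α : ℝ) < γ) :
    ∃ K ⊆ Ω, IsCompact K ∧ ∃ C : ℝ≥0, ∀ (f : 𝔼 → ℝ) (G : 𝔼 → 𝔼),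
      Measurable f → Measurable G → IsWeakGradient Ω f G →
        ∫⁻ x in Ω, ENNReal.ofReal (bdryDist Ω x ^ γ) * ‖f x‖ₑ ^ p ≤
          C * ((∫⁻ x in K, ENNReal.ofReal (bdryDist Ω x ^ γ) * ‖f x‖ₑ ^ p) +
            ∫⁻ x in Ω, ENNReal.ofReal (bdryDist Ω x ^ (γ + α * p)) * ‖G x‖ₑ ^ p) := by
  have hcl : IsCompact (closure Ω) := hΩ.2.2.1.isCompact_closure
  have hfr : IsCompact (frontier Ω) := hcl.of_isClosed_subset isClosed_frontier
    frontier_subset_closure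
  obtain ⟨V, hVo, hV, K, hKΩ, hK, C, hC⟩ : ∃ V, IsOpen V ∧ frontier Ω ⊆ V ∧
      ∃ K ⊆ Ω, IsCompact K ∧ ∃ C : ℝ≥0, ∀ (f : 𝔼 → ℝ) (G : 𝔼 → 𝔼),
      Measurable f → Measurable G → IsWeakGradient Ω f G →
        ∫⁻ x in V ∩ Ω, ENNReal.ofReal (bdryDist Ω x ^ γ) * ‖f x‖ₑ ^ p ≤
          C * ((∫⁻ x in K, ENNReal.ofReal (bdryDist Ω x ^ γ) * ‖f x‖ₑ ^ p) +
            ∫⁻ x in Ω, ENNReal.ofReal (bdryDist Ω x ^ (γ + α * p)) * ‖G x‖ₑ ^ p) := by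
    -- The local inequalities are stable under finite unions: the neighbourhoods and the compact
    -- sets are united and the constants added.
    refine hfr.induction_on (p := fun S => ∃ V, IsOpen V ∧ S ⊆ V ∧
      ∃ K ⊆ Ω, IsCompact K ∧ ∃ C : ℝ≥0, ∀ (f : 𝔼 → ℝ) (G : 𝔼 → 𝔼),
      Measurable f → Measurable G → IsWeakGradient Ω f G →
        ∫⁻ x in V ∩ Ω, ENNReal.ofReal (bdryDist Ω x ^ γ) * ‖f x‖ₑ ^ p ≤
          C * ((∫⁻ x in K, ENNReal.ofReal (bdryDist Ω x ^ γ) * ‖f x‖ₑ ^ p) +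
            ∫⁻ x in Ω, ENNReal.ofReal (bdryDist Ω x ^ (γ + α * p)) * ‖G x‖ₑ ^ p))
      ⟨∅, isOpen_empty, Subset.rfl, ∅, empty_subset _, isCompact_empty, 0, by simp⟩ ?_ ?_ ?_
    · rintro s t hst ⟨V, hVo, hV, h⟩
      exact ⟨V, hVo, hst.trans hV, h⟩
    · rintro s t ⟨V, hVo, hV, K, hKΩ, hK, C, hC⟩ ⟨V', hVo', hV', K', hKΩ', hK', C', hC'⟩
      refine ⟨V ∪ V', hVo.union hVo', union_subset_union hV hV', K ∪ K', union_subset hKΩ hKΩ',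
        hK.union hK', C + C', fun f G hf hG hfG => ?_⟩
      rw [union_inter_distrib_right, ENNReal.coe_add, add_mul]
      refine (lintegral_union_le _ _ _).trans (add_le_add ((hC f G hf hG hfG).trans ?_)
        ((hC' f G hf hG hfG).trans ?_))
      · gcongr
        exact subset_union_left
      · gcongr
        exact subset_union_right
    · intro z hz
      obtain ⟨U, hU, K, hKΩ, hK, C, hC⟩ := hΩ.exists_local_hardy hα hα1 hp hγ hz
      obtain ⟨W, hWU, hWo, hzW⟩ := _root_.mem_nhds_iff.1 hU
      refine ⟨W, mem_nhdsWithin_of_mem_nhds (hWo.mem_nhds hzW), W, hWo, Subset.rfl, K, hKΩ, hK, C,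
        fun f G hf hG hfG => (lintegral_mono_set ?_).trans (hC f G hf hG hfG)⟩
      exact inter_subset_inter_left _ hWU
  -- What the boundary neighbourhood leaves uncovered is compact in Ω and joins the interior term
  -- with constant 1.
  have hdiff : closure Ω \ V ⊆ Ω := by
    rintro x ⟨hx, hxV⟩
    by_contra hxΩ
    exact hxV (hV (hΩ.1.frontier_eq ▸ ⟨hx, hxΩ⟩))
  refine ⟨K ∪ closure Ω \ V, union_subset hKΩ hdiff, hK.union (hcl.diff hVo), C + 1,
    fun f G hf hG hfG => ?_⟩
  have hcov : Ω ⊆ (V ∩ Ω) ∪ (closure Ω \ V) := fun x hx => by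
    by_cases hxV : x ∈ V
    · exact Or.inl ⟨hxV, hx⟩
    · exact Or.inr ⟨subset_closure hx, hxV⟩
  rw [ENNReal.coe_add, ENNReal.coe_one, add_mul, one_mul]
  refine ((lintegral_mono_set hcov).trans (lintegral_union_le _ _ _)).trans
    (add_le_add ((hC f G hf hG hfG).trans ?_) ?_)
  · gcongr
    exact subset_union_left
  · exact (lintegral_mono_set subset_union_right).trans le_self_add

theorem eLpNorm_distMeasure {F : Type*} [NormedAddCommGroup F] [MeasurableSpace F]
    [OpensMeasurableSpace F] {p γ : ℝ} (hp : 0 < p) {f : 𝔼 → F} (hf : Measurable f) :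
    eLpNorm f (ENNReal.ofReal p) (distMeasure Ω γ) =
      (∫⁻ x in Ω, ENNReal.ofReal (bdryDist Ω x ^ γ) * ‖f x‖ₑ ^ p) ^ (1 / p) := by
  rw [eLpNorm_eq_lintegral_rpow_enorm_toReal (by simpa using hp) ENNReal.ofReal_ne_top,
    ENNReal.toReal_ofReal hp.le, distMeasure,
    lintegral_withDensity_eq_lintegral_mul _ (measurable_ofReal_bdryDist_rpow γ)
      (hf.enorm.pow_const p)]
  rfl

/-- The Hardy inequality for the constant 1, with exponent 2: the gradient term vanishes and d^γ is
bounded on K. -/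
theorem IsHolderDomain.distMeasure_univ_lt_top {α : ℝ≥0} (hα : 0 < α) (hα1 : α ≤ 1)
    (hΩ : IsHolderDomain α Ω) (hne : (frontier Ω).Nonempty) {γ : ℝ} (hγ : -(α : ℝ) < γ) :
    distMeasure Ω γ univ < ⊤ := by
  obtain ⟨K, hKΩ, hK, C, hC⟩ := hΩ.exists_hardy hα hα1 one_lt_two hγ
  have h := hC (fun _ => 1) (fun _ => 0) measurable_const measurable_const (isWeakGradient_const 1)
  simp only [enorm_one, ENNReal.one_rpow, mul_one, enorm_zero, ENNReal.zero_rpow_of_pos two_pos,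
    mul_zero, lintegral_zero, add_zero] at h
  rw [distMeasure, withDensity_apply _ MeasurableSet.univ, Measure.restrict_univ]
  refine h.trans_lt (ENNReal.mul_lt_top ENNReal.coe_lt_top ?_)
  have hcont : ContinuousOn (fun y => bdryDist Ω y ^ γ) K :=
    continuous_bdryDist.continuousOn.rpow_const fun y hy =>
      Or.inl (bdryDist_pos hΩ.1 hne (hKΩ hy)).ne'
  exact (hcont.integrableOn_compact hK).lintegral_lt_top

/-- **Improved Poincaré inequality** on a Hölder domain, up to an additive constant. -/
theorem IsHolderDomain.exists_eLpNorm_sub_const_le {α : ℝ≥0} (hα : 0 < α) (hα1 : α ≤ 1)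
    (hΩ : IsHolderDomain α Ω) (hne : (frontier Ω).Nonempty) {p γ : ℝ} (hp : 1 < p)
    (hγ : -(α : ℝ) < γ) :
    ∃ C : ℝ≥0, ∀ (f : 𝔼 → ℝ) (G : 𝔼 → 𝔼), Measurable f → Measurable G → IsWeakGradient Ω f G →
      ∃ c : ℝ, eLpNorm (fun x => f x - c) (ENNReal.ofReal p) (distMeasure Ω γ) ≤
        C * eLpNorm G (ENNReal.ofReal p) (distMeasure Ω (γ + α * p)) := by
  have hp0 : 0 < p := by linarith
  obtain ⟨K, hKΩ, hK, C, hC⟩ := hΩ.exists_hardy hα hα1 hp hγ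
  obtain ⟨A, hAm, hA0, hAt, -, hA⟩ := exists_oscBound_isCompact
    (v := fun x => ENNReal.ofReal (bdryDist Ω x ^ (γ + α * p))) hΩ.1 hΩ.2.1 hp.le fun z hz => by
      have hd := bdryDist_pos hΩ.1 hne hz
      have hpos : 0 < bdryDist Ω z ^ (γ + α * p) := by positivity
      have hcont : ContinuousAt (fun y => bdryDist Ω y ^ (γ + α * p)) z :=
        continuous_bdryDist.continuousAt.rpow_const (Or.inl hd.ne')
      refine ⟨(bdryDist Ω z ^ (γ + α * p) / 2).toNNReal, by simpa using hpos, ?_⟩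
      filter_upwards [hcont.eventually_const_lt (half_lt_self hpos)] with y hy
      exact ENNReal.ofReal_le_ofReal hy.le
  obtain ⟨C₀, hC₀⟩ := hA K hKΩ hK
  obtain ⟨b, hb⟩ : ∃ b : ℝ, ∀ x ∈ K, bdryDist Ω x ^ γ ≤ b := by
    have hcont : ContinuousOn (fun y => bdryDist Ω y ^ γ) K :=
      continuous_bdryDist.continuousOn.rpow_const fun y hy =>
        Or.inl (bdryDist_pos hΩ.1 hne (hKΩ hy)).ne'
    obtain ⟨b, hb⟩ := (hK.image_of_continuousOn hcont).bddAbove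
    exact ⟨b, fun x hx => hb (mem_image_of_mem _ hx)⟩
  set Q : ℝ≥0∞ := C * (ENNReal.ofReal b * (C₀ / volume A) + 1) with hQ
  have hQt : Q ≠ ⊤ := by
    have : (C₀ : ℝ≥0∞) / volume A ≠ ⊤ := ENNReal.div_ne_top ENNReal.coe_ne_top hA0
    finiteness
  refine ⟨(Q ^ (1 / p)).toNNReal, fun f G hf hG hfG => ?_⟩
  set I := ∫⁻ x in Ω, ENNReal.ofReal (bdryDist Ω x ^ (γ + α * p)) * ‖G x‖ₑ ^ p with hI
  have hm := measurable_enorm_sub_rpow (p := p) hf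
  -- Some y ∈ A does no worse than the average over A; f y is the constant to subtract.
  obtain ⟨y, -, hy⟩ := exists_le_setLAverage hA0 hAt
    (f := fun y => ∫⁻ x in K, ‖f y - f x‖ₑ ^ p) hm.lintegral_prod_right'.aemeasurable
  rw [setLAverage_eq] at hy
  have hy' : ∫⁻ x in K, ‖f x - f y‖ₑ ^ p ≤ C₀ / volume A * I := by
    simp_rw [enorm_sub_rev (f _) (f y)]
    refine hy.trans ?_
    rw [ENNReal.div_eq_inv_mul, ENNReal.div_eq_inv_mul, mul_assoc]
    gcongr
    exact hC₀ f G hf hG hfG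
  refine ⟨f y, ?_⟩
  rw [ENNReal.coe_toNNReal (ENNReal.rpow_ne_top_of_nonneg (by positivity) hQt),
    eLpNorm_distMeasure hp0 (hf.sub_const _), eLpNorm_distMeasure hp0 hG,
    ← ENNReal.mul_rpow_of_nonneg _ _ (by positivity)]
  refine ENNReal.rpow_le_rpow ?_ (by positivity)
  refine (hC _ G (hf.sub_const (f y)) hG (hfG.sub_const (f y))).trans ?_
  rw [hQ, mul_assoc, add_mul, one_mul]
  gcongr
  calc ∫⁻ x in K, ENNReal.ofReal (bdryDist Ω x ^ γ) * ‖f x - f y‖ₑ ^ p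
      ≤ ∫⁻ x in K, ENNReal.ofReal b * ‖f x - f y‖ₑ ^ p :=
        setLIntegral_mono' hK.measurableSet fun x hx => by
          gcongr
          exact hb x hx
    _ = ENNReal.ofReal b * ∫⁻ x in K, ‖f x - f y‖ₑ ^ p :=
        lintegral_const_mul' _ _ ENNReal.ofReal_ne_top
    _ ≤ _ := by
        rw [mul_assoc]
        gcongr

/-- A function of mean zero is controlled by its distance to the constants. -/
theorem eLpNorm_le_two_mul_eLpNorm_sub_const {X : Type*} [MeasurableSpace X] {μ : Measure X}
    [IsFiniteMeasure μ] {q : ℝ≥0∞} (hq : 1 ≤ q) {f : X → ℝ} (hf : MemLp f q μ)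
    (h0 : ∫ x, f x ∂μ = 0) (c : ℝ) :
    eLpNorm f q μ ≤ 2 * eLpNorm (fun x => f x - c) q μ := by
  rcases eq_or_ne μ 0 with rfl | hμ
  · simp
  have hq0 : q ≠ 0 := (zero_lt_one.trans_le hq).ne'
  have hfc : MemLp (fun x => f x - c) q μ := hf.sub (memLp_const c)
  have hint : ∫ x, (f x - c) ∂μ = -(μ.real univ * c) := by
    rw [integral_sub (hf.integrable hq) (integrable_const c), h0]
    simp
  have hμ0 : μ univ ≠ 0 := by simpa using hμ
  have hμt : μ univ ≠ ⊤ := measure_ne_top μ univ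
  -- As f has mean zero, the integral of f - c is -c μ(X); Hölder's inequality then bounds the norm
  -- of the constant c by that of f - c.
  have h1 : ‖c‖ₑ * μ univ ≤ eLpNorm (fun x => f x - c) q μ * μ univ ^ (1 - 1 / q.toReal) := by
    calc ‖c‖ₑ * μ univ = ‖∫ x, (f x - c) ∂μ‖ₑ := by
          rw [hint, enorm_neg, enorm_mul, mul_comm, Real.enorm_eq_ofReal measureReal_nonneg,
            ofReal_measureReal]
      _ ≤ ∫⁻ x, ‖f x - c‖ₑ ∂μ := enorm_integral_le_lintegral_enorm _
      _ = eLpNorm (fun x => f x - c) 1 μ := eLpNorm_one_eq_lintegral_enorm.symm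
      _ ≤ _ := by
          have := eLpNorm_le_eLpNorm_mul_rpow_measure_univ hq hfc.1
          simpa using this
  have h2 : eLpNorm (fun _ : X => c) q μ ≤ eLpNorm (fun x => f x - c) q μ := by
    rw [eLpNorm_const c hq0 hμ]
    have hpow : μ univ ^ (1 / q.toReal) * μ univ ^ (1 - 1 / q.toReal) = μ univ := by
      rw [← ENNReal.rpow_add _ _ hμ0 hμt, add_sub_cancel, ENNReal.rpow_one]
    refine (ENNReal.mul_le_mul_iff_left (c := μ univ ^ (1 - 1 / q.toReal))
      (ENNReal.rpow_pos hμ0.bot_lt hμt).ne' (ENNReal.rpow_ne_top_of_ne_zero hμ0 hμt)).1 ?_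
    rwa [mul_assoc, hpow]
  calc eLpNorm f q μ = eLpNorm ((fun x => f x - c) + fun _ => c) q μ := by
        congr 1
        funext x
        simp
    _ ≤ eLpNorm (fun x => f x - c) q μ + eLpNorm (fun _ => c) q μ :=
        eLpNorm_add_le hfc.1 aestronglyMeasurable_const hq
    _ ≤ eLpNorm (fun x => f x - c) q μ + eLpNorm (fun x => f x - c) q μ := by gcongr
    _ = _ := (two_mul _).symm

theorem distMeasure_absolutelyContinuous (γ : ℝ) : distMeasure Ω γ ≪ volume.restrict Ω :=
  withDensity_absolutelyContinuous _ _

theorem IsWeakGradient.congr {f f' : 𝔼 → ℝ} {G G' : 𝔼 → 𝔼} (hΩ : IsOpen Ω)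
    (h : IsWeakGradient Ω f G) (hf : f =ᵐ[volume.restrict Ω] f')
    (hG : G =ᵐ[volume.restrict Ω] G') : IsWeakGradient Ω f' G' := by
  refine ⟨?_, ?_, fun ψ hψ hψc hψs i => ?_⟩
  · rw [locallyIntegrableOn_iff hΩ.isLocallyClosed]
    intro k hk hkc
    exact (h.1.integrableOn_compact_subset hk hkc).congr
      (ae_restrict_of_ae_restrict_of_subset hk hf)
  · rw [locallyIntegrableOn_iff hΩ.isLocallyClosed]
    intro k hk hkc
    exact (h.2.1.integrableOn_compact_subset hk hkc).congr
      (ae_restrict_of_ae_restrict_of_subset hk hG)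
  · have := h.2.2 ψ hψ hψc hψs i
    have h1 : ∫ x in Ω, f x * fderiv ℝ ψ x (EuclideanSpace.single i 1) =
        ∫ x in Ω, f' x * fderiv ℝ ψ x (EuclideanSpace.single i 1) :=
      integral_congr_ae (hf.mono fun x hx => by simp only [hx])
    have h2 : ∫ x in Ω, G x i * ψ x = ∫ x in Ω, G' x i * ψ x :=
      integral_congr_ae (hG.mono fun x hx => by simp only [hx])
    rwa [h1, h2] at this

/-- Needed because `Metric.infDist` to the empty set is 0 by convention, so d > 0 on Ω requires a
boundary point. -/
theorem frontier_nonempty_of_isBounded (hn : 0 < n) (hne : Ω.Nonempty)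
    (hb : Bornology.IsBounded Ω) : (frontier Ω).Nonempty := by
  have : Nonempty (Fin n) := ⟨⟨0, hn⟩⟩
  refine nonempty_frontier_iff.2 ⟨hne, fun h => ?_⟩
  exact NormedSpace.unbounded_univ ℝ 𝔼 (h ▸ hb)

end Global

theorem mainTheorem4 (n : ℕ) (hn : 2 ≤ n) (p : ℝ) (hp : 1 < p) (α : ℝ≥0) (hα : 0 < α)
    (hα1 : α ≤ 1) (β : ℝ) (hβ : -(α : ℝ) < β * p)
    (Ω : Set (EuclideanSpace ℝ (Fin n))) (hΩ : IsHolderDomain α Ω) :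
    ∃ C : ℝ≥0, ∀ (f : EuclideanSpace ℝ (Fin n) → ℝ)
      (G : EuclideanSpace ℝ (Fin n) → EuclideanSpace ℝ (Fin n)),
      MemLp f (ENNReal.ofReal p) (distMeasure Ω (β * p)) →
      ∫ x in Ω, f x * bdryDist Ω x ^ (β * p) = 0 →
      IsWeakGradient Ω f G →
      eLpNorm f (ENNReal.ofReal p) (distMeasure Ω (β * p)) ≤
        C * eLpNorm G (ENNReal.ofReal p) (distMeasure Ω ((β + α) * p)) := by
  have hne : (frontier Ω).Nonempty :=
    frontier_nonempty_of_isBounded (by omega) hΩ.2.1.nonempty hΩ.2.2.1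
  have : IsFiniteMeasure (distMeasure Ω (β * p)) :=
    ⟨hΩ.distMeasure_univ_lt_top hα hα1 hne hβ⟩
  obtain ⟨C, hC⟩ := hΩ.exists_eLpNorm_sub_const_le hα hα1 hne hp hβ
  refine ⟨2 * C, fun f G hf hmean hfG => ?_⟩
  have hfm : AEStronglyMeasurable f (volume.restrict Ω) := hfG.1.aestronglyMeasurable
  have hGm : AEStronglyMeasurable G (volume.restrict Ω) := hfG.2.1.aestronglyMeasurable
  -- The preceding estimates need measurable functions; f and G are replaced by measurable
  -- representatives, which changes neither the norms nor the weak gradient relation.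
  have hff' := hfm.ae_eq_mk
  have hGG' := hGm.ae_eq_mk
  obtain ⟨c, hc⟩ := hC _ _ hfm.stronglyMeasurable_mk.measurable
    hGm.stronglyMeasurable_mk.measurable (hfG.congr hΩ.1 hff' hGG')
  have hmean' : ∫ x, f x ∂distMeasure Ω (β * p) = 0 := by
    rw [distMeasure, integral_withDensity_eq_integral_toReal_smul
      (measurable_ofReal_bdryDist_rpow _) (Eventually.of_forall fun _ => ENNReal.ofReal_lt_top)]
    rw [← hmean]
    refine integral_congr_ae (Eventually.of_forall fun x => ?_)
    simp only [smul_eq_mul]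
    rw [ENNReal.toReal_ofReal (Real.rpow_nonneg (bdryDist_nonneg x) _), mul_comm]
  have h1 : eLpNorm (fun x => f x - c) (ENNReal.ofReal p) (distMeasure Ω (β * p)) =
      eLpNorm (fun x => hfm.mk f x - c) (ENNReal.ofReal p) (distMeasure Ω (β * p)) :=
    eLpNorm_congr_ae (((distMeasure_absolutelyContinuous _).ae_eq hff').mono
      fun x hx => by simp only [hx])
  have h2 := eLpNorm_congr_ae (p := ENNReal.ofReal p)
    ((distMeasure_absolutelyContinuous (Ω := Ω) (β * p + α * p)).ae_eq hGG')
  rw [add_mul β]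
  refine (eLpNorm_le_two_mul_eLpNorm_sub_const (ENNReal.one_le_ofReal.2 hp.le) hf hmean' c).trans ?_
  rw [h1, h2, ENNReal.coe_mul, mul_assoc, ENNReal.coe_ofNat]
  gcongr
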